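/- Let $0<p<1$. In the Bernoulli model a series-parallel network (a directed multigraph with labelled edges) grows as follows. In step $1$ one starts with a single edge, labelled $1$, from the source to the sink. In step $n>1$ one of the $n-1$ edges of the network is chosen uniformly at random, say the edge $j=(x,y)$; independently, with probability $p$ an additional parallel edge $(x,y)$ labelled $n$ is inserted, and with probability $1-p$ the edge $(x,y)$ is replaced by the two edges $(x,z)$, labelled $j$, and $(z,y)$, labelled $n$, where $z$ is a new node. Let $P_n$ be the number of different directed paths from the source to the sink in the resulting random network with $n$ edges (paths using different parallel edges are different). **Theorem.** The random variable $P_n$ has finite expectation, and for all $n\ge 1$ $$ \mathbb{E}(P_n)=\begin{cases} \displaystyle\sum_{j=0}^{n-1}(-1)^{n+j-1}\binom{(2p-1)j-1}{n-1}\sum_{k=0}^{n-1}\binom{k}{j}\Big(\frac{p}{2p-1}\Big)^{k}, & p\neq\tfrac12,\\[3mm] \displaystyle\sum_{k=0}^{n-1}\frac{(-1)^k}{2^k}\,B_k\big(-H_{n-1}^{(1)},-H_{n-1}^{(2)},-2!\,H_{n-1}^{(3)},\ldots,-(k-1)!\,H_{n-1}^{(k)}\big), & p=\tfrac12, \end{cases}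 $$ where $\binom{x}{r}=x(x-1)\cdots(x-r+1)/r!$ for real $x$, where $H_n^{(m)}=\sum_{j=1}^n j^{-m}$, and where $B_k$ is the $k$-th complete Bell polynomial, given by $\sum_{k\ge0}B_k(x_1,\ldots,x_k)\frac{t^k}{k!}=\exp\big(\sum_{m\ge1}x_m\frac{t^m}{m!}\big)$. Moreover, for fixed $p$ and $n\to\infty$, $$ \mathbb{E}(P_n)=\frac{1}{1-p}\,\alpha_p^{\,n}+R_p(n), $$ where $$ \alpha_p=\frac{1}{1-\big(\frac{p}{1-p}\big)^{\frac{1}{1-2p}}}\ \text{ for } p\neq\tfrac12,\qquad \alpha_{1/2}=\frac{1}{1-e^{-2}}=\lim_{p\to\frac12}\frac{1}{1-\big(\frac{p}{1-p}\big)^{\frac{1}{1-2p}}}, $$ and $$ R_p(n)=\begin{cases} -\dfrac{1-2p}{p\,\Gamma(2p)}\,n^{2p-1}+\mathcal{O}\big(n^{2(2p-1)}\big), & 0<p<\tfrac12,\\[2mm] -\dfrac{2}{\log n}+\mathcal{O}\Big(\dfrac{1}{\log^2 n}\Big), & p=\tfrac12,\\[2mm] -\dfrac{2p-1}{1-p}+\mathcal{O}\big(n^{1-2p}\big),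 & \tfrac12<p<1, \end{cases} $$ with implied constants that may depend on $p$. -/

import Mathlib

open Filter Topology MeasureTheory ProbabilityTheory

/-! ## Labelled two-terminal networks -/

/-- A network with `n` labelled directed edges. Parallel edges are allowed. The nodes are named by
natural numbers; node `0` is the source and node `1` is the sink. The edge labels `1, …, n` are
represented by `0, …, n - 1`. The edge with label `e` goes from `tail e` to `head e`. -/
@[ext]
structure Network (n : ℕ) where
  tail : Fin n → ℕ
  head : Fin n → ℕ

namespace Network

/-- The source of every network. -/
def source : ℕ := 0

/-- The sink of every network. -/
def sink : ℕ := 1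

/-- The network consisting of a single edge from the source to the sink. -/
def single : Network 1 where
  tail := fun _ => source
  head := fun _ => sink

/-- Parallel doubling of the edge `j = (x, y)`: an additional edge `(x, y)`, carrying the next free
label, is inserted. -/
def parallel {n : ℕ} (G : Network n) (j : Fin n) : Network (n + 1) where
  tail := Fin.snoc (α := fun _ => ℕ) G.tail (G.tail j)
  head := Fin.snoc (α := fun _ => ℕ) G.head (G.head j)

/-- Serial doubling of the edge `j = (x, y)`: it is replaced by `(x, z)` and `(z, y)`, where `z` is
a new node, `(x, z)` keeps the label `j` and `(z, y)` carries the next free label.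

The node created when the network grows from `n` to `n + 1` edges is named `n + 1`. In a network
grown from `single` all the node names at that time are at most `n`, so this node is indeed new. -/
def serial {n : ℕ} (G : Network n) (j : Fin n) : Network (n + 1) where
  tail := Fin.snoc (α := fun _ => ℕ) G.tail (n + 1)
  head := Fin.snoc (α := fun _ => ℕ) (Function.update G.head j (n + 1)) (G.head j)

/-- `G.IsWalk x l y`: the list `l` of edges is a directed walk from the node `x` to the node `y`. -/
def IsWalk {n : ℕ} (G : Network n) : ℕ → List (Fin n) → ℕ → Prop
  | x, [], y => x = y
  | x, e :: l, y => G.tail e = x ∧ G.IsWalk (G.head e) l y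

/-- `G.IsPath x l y`: the list `l` of edges is a directed path from `x` to `y`, that is, a directed
walk that visits no node twice. Paths are sequences of edges, so paths that use different parallel
edges are different. -/
def IsPath {n : ℕ} (G : Network n) (x : ℕ) (l : List (Fin n)) (y : ℕ) : Prop :=
  G.IsWalk x l y ∧ (x :: l.map G.head).Nodup

/-- The number of different paths from the source to the sink. -/
noncomputable def numPaths {n : ℕ} (G : Network n) : ℕ :=
  {l : List (Fin n) | G.IsPath source l sink}.ncard

instance {n : ℕ} : MeasurableSpace (Network n) := ⊤

instance {n : ℕ} : DiscreteMeasurableSpace (Network n) := ⟨fun _ => trivial⟩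

end Network

/-! ## The Bernoulli model -/

/-- The law of a random biased coin, which shows `true` with probability `p` and `false` with
probability `1 - p`. -/
noncomputable def coin (p : unitInterval) : PMF Bool :=
  (bernoulliMeasure true false p).toPMF

/-- One growth step of the Bernoulli model: one of the edges is chosen uniformly at random, and then
it is doubled in a parallel way with probability `p`, and in a serial way with probability
`1 - p`. -/
noncomputable def bernoulliStep (p : unitInterval) {m : ℕ} (G : Network (m + 1)) :
    PMF (Network (m + 2)) :=
  (PMF.uniformOfFintype (Fin (m + 1))).bind fun j =>
    (coin p).map fun b => if b then G.parallel j else G.serial j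

/-- The law of the random series-parallel network of size `m + 1` generated by the Bernoulli
model: a single edge grown by `m` steps. -/
noncomputable def bernoulliNetwork (p : unitInterval) : (m : ℕ) → PMF (Network (m + 1))
  | 0 => PMF.pure Network.single
  | m + 1 => (bernoulliNetwork p m).bind (bernoulliStep p)

/-- The expectation `E(P_n)` of the number of source-to-sink paths in the random series-parallel
network of size `n ≥ 1` (there is no network of size `0`, and the value there is a dummy). -/
noncomputable def expectedPaths (p : unitInterval) : ℕ → ℝ
  | 0 => 0
  | m + 1 => ∫ G, (G.numPaths : ℝ) ∂(bernoulliNetwork p m).toMeasure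

/-! ## Bell polynomials, harmonic numbers and the growth constant -/

/-- The value `B_k(x_1, …, x_k)` of the `k`-th complete Bell polynomial, defined by the exponential
generating function `∑_k B_k(x_1, …, x_k) t^k / k! = exp (∑_{m ≥ 1} x_m t^m / m!)`. -/
noncomputable def completeBell (k : ℕ) (x : ℕ → ℝ) : ℝ :=
  k.factorial * PowerSeries.coeff k ((PowerSeries.exp ℝ).subst
    (PowerSeries.mk fun m => if m = 0 then 0 else x m / m.factorial))

/-- The `m`-th order harmonic number `H_n^{(m)}`. -/
noncomputable def harmonicNumber (m n : ℕ) : ℝ :=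
  ∑ j ∈ Finset.Icc 1 n, 1 / (j : ℝ) ^ m

/-- The exponential growth rate `α_p` for `p ≠ 1 / 2`. -/
noncomputable def growthRateGeneric (p : ℝ) : ℝ :=
  1 / (1 - (p / (1 - p)) ^ (1 / (1 - 2 * p)))

open Classical in
/-- The exponential growth rate `α_p`. -/
noncomputable def growthRate (p : ℝ) : ℝ :=
  if p = 1 / 2 then 1 / (1 - Real.exp (-2)) else growthRateGeneric p

/-! The number of paths alone does not evolve autonomously, but the numbers of paths of each length
do. A path of length `s` in a network with `n` edges contains the chosen edge for `s` of the `n`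
choices. If it does, parallel doubling turns it into two paths of length `s`, and serial doubling
into one path of length `s + 1`; otherwise it survives unchanged. Averaging gives a linear recursion
for the expected number of paths of given length (`expectedPathsOfLength_succ`).

In generating functions the recursion is a first-order differential equation, solved by `f * ((1 -
p) V) ^ l` for length `l + 1`, where `f = (1 - X) ^ (-2p)` and `V` is its antiderivative. Summing
the geometric series over `l` gives `∑ E(P_{m+1}) X ^ m = f / (1 - (1 - p) V)`. For `p ≠ 1/2` the
series `V` is elementary and expanding in powers of `(1 - X) ^ (2p - 1)` yields the binomial
formula. For `p = 1/2` one has `V = -log (1 - X)`; the coefficients of `(1 - X)⁻¹ log (1 - X) ^ k`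
are `k!` times those of `∏ (1 - X / j)`, whose logarithm has the harmonic numbers as coefficients,
whence the Bell polynomials.

For the asymptotics, the generating function has one simple pole in the plane cut along `[1, ∞)`; it
produces `α_p ^ n / (1 - p)`. The remainder comes from the singularity at `1`. If a quotient is
`O(|z - 1| ^ M)` there, then Cauchy estimates on small discs bound its `M`-th derivative, and its
coefficients without the pole are `O(n ^ (-M))` (`isBigO_coeff_of_simple_pole`). The actual
functions are reduced to such quotients. For `p ≠ 1/2`, finitely many terms `(1 - X) ^ β` of the
singular expansion are split off (`oneSubPow_mul_inv_eq_add`). For `p = 1/2`, integrating `2 exp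
(2x) (1 - X) ^ (x - 1)` over `0 ≤ x ≤ 2` replaces the numerator `(1 - X)⁻¹` by `exp 4 * (1 - X)`,
and the integral itself supplies the term in `1 / log n`. -/

theorem List.ncard_setOf_map_eq {α β : Type*} [Finite α] (f : α → β) (l₀ : List β) :
    {l : List α | l.map f = l₀}.ncard = (l₀.map fun b => (f ⁻¹' {b}).ncard).prod := by
  induction l₀ with
  | nil => simp
  | cons b t ih =>
    have h : {l : List α | l.map f = b :: t} =
        (fun q : α × List α => q.1 :: q.2) '' ((f ⁻¹' {b}) ×ˢ {l : List α | l.map f = t}) := by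
      ext l
      cases l <;> simp
    rw [h, Set.ncard_image_of_injective _ (by rintro ⟨a, l⟩ ⟨a', l'⟩; simp), Set.ncard_prod, ih,
      List.map_cons, List.prod_cons]

/-! ### Path sums under parallel and serial doubling -/

namespace Network

variable {n : ℕ}

theorem IsPath.nodup_map_head {G : Network n} {x y : ℕ} {l : List (Fin n)} (h : G.IsPath x l y) :
    (l.map G.head).Nodup :=
  (List.nodup_cons.1 h.2).2

theorem IsPath.nodup {G : Network n} {x y : ℕ} {l : List (Fin n)} (h : G.IsPath x l y) : l.Nodup :=
  h.nodup_map_head.of_map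

theorem finite_setOf_nodup (n : ℕ) : {l : List (Fin n) | l.Nodup}.Finite :=
  (List.finite_length_le (Fin n) n).subset fun l hl => by
    simpa using List.Nodup.length_le_card hl

theorem finite_setOf_isPath (G : Network n) : {l | G.IsPath source l sink}.Finite :=
  (finite_setOf_nodup n).subset fun _ hl => hl.nodup

/-- The finite set of all paths from the source to the sink. -/
noncomputable def paths (G : Network n) : Finset (List (Fin n)) :=
  G.finite_setOf_isPath.toFinset

@[simp]
theorem mem_paths {G : Network n} {l : List (Fin n)} : l ∈ G.paths ↔ G.IsPath source l sink := by
  simp [paths]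

theorem numPaths_eq_card_paths (G : Network n) : G.numPaths = G.paths.card := by
  rw [numPaths, paths, Set.ncard_eq_toFinset_card _ G.finite_setOf_isPath]

theorem length_le_of_mem_paths {G : Network n} {l : List (Fin n)} (h : l ∈ G.paths) :
    l.length ≤ n := by
  simpa using (mem_paths.1 h).nodup.length_le_card

theorem length_pos_of_mem_paths {G : Network n} {l : List (Fin n)} (h : l ∈ G.paths) :
    0 < l.length := by
  rw [mem_paths] at h
  cases l with
  | nil => simpa [IsWalk, source, sink] using h.1
  | cons => simp

/-- The sum over all source-to-sink paths of a weight that depends on the length of the path. -/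
noncomputable def pathSum (w : ℕ → ℝ) (G : Network n) : ℝ :=
  ∑ l ∈ G.paths, w l.length

/-- A path repeats no edge, so exactly `l.length` of the `n` choices of `j` hit it. This is why the
growth step acts on path lengths alone. -/
theorem sum_ite_mem_paths {G : Network n} {l : List (Fin n)} (h : l ∈ G.paths) (a b : ℝ) :
    ∑ j, (if j ∈ l then a else b) = l.length * a + (n - l.length) * b := by
  classical
  have hcard : (l.toFinset.card : ℝ) = l.length := by
    rw [List.toFinset_card_of_nodup (mem_paths.1 h).nodup]
  have h1 : ∀ j, (if j ∈ l then a else b) = b + if j ∈ l.toFinset then a - b else 0 := by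
    intro j
    by_cases hj : j ∈ l <;> simp [hj]
  simp_rw [h1]
  rw [Finset.sum_add_distrib, Finset.sum_ite_mem]
  simp [hcard]
  ring

/-! ### Parallel doubling -/

/-- The edge of the original network from which an edge of the doubled network descends. -/
def origin (j : Fin n) : Fin (n + 1) → Fin n :=
  Fin.snoc (α := fun _ => Fin n) id j

theorem parallel_tail (G : Network n) (j : Fin n) : (G.parallel j).tail = G.tail ∘ origin j := by
  funext e
  refine Fin.lastCases ?_ (fun i => ?_) e <;> simp [parallel, origin]

theorem parallel_head (G : Network n) (j : Fin n) : (G.parallel j).head = G.head ∘ origin j := by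
  funext e
  refine Fin.lastCases ?_ (fun i => ?_) e <;> simp [parallel, origin]

theorem isWalk_parallel (G : Network n) (j : Fin n) (l : List (Fin (n + 1))) (x y : ℕ) :
    (G.parallel j).IsWalk x l y ↔ G.IsWalk x (l.map (origin j)) y := by
  induction l generalizing x with
  | nil => rfl
  | cons e l ih => simp [IsWalk, ih, parallel_tail, parallel_head]

theorem isPath_parallel (G : Network n) (j : Fin n) (l : List (Fin (n + 1))) (x y : ℕ) :
    (G.parallel j).IsPath x l y ↔ G.IsPath x (l.map (origin j)) y := by
  simp [IsPath, isWalk_parallel, parallel_head]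

theorem ncard_preimage_origin (j b : Fin n) :
    (origin j ⁻¹' {b}).ncard = if b = j then 2 else 1 := by
  split_ifs with h
  · have : origin j ⁻¹' {b} = {b.castSucc, Fin.last n} := by
      ext e
      refine Fin.lastCases ?_ (fun i => ?_) e
      · simp [origin, h]
      · simp [origin, Fin.castSucc_ne_last]
    rw [this, Set.ncard_pair (Fin.castSucc_ne_last b)]
  · have : origin j ⁻¹' {b} = {b.castSucc} := by
      ext e
      refine Fin.lastCases ?_ (fun i => ?_) e
      · simpa [origin, (Fin.castSucc_ne_last b).symm] using fun h' => h h'.symm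
      · simp [origin]
    rw [this, Set.ncard_singleton]

/-- Only `j` has two lifts under `origin j`, and it occurs at most once in a list without
duplicates. -/
theorem ncard_setOf_map_origin_eq (j : Fin n) {l₀ : List (Fin n)} (hl : l₀.Nodup) :
    {l : List (Fin (n + 1)) | l.map (origin j) = l₀}.ncard = if j ∈ l₀ then 2 else 1 := by
  rw [List.ncard_setOf_map_eq]
  simp only [ncard_preimage_origin]
  induction l₀ with
  | nil => simp
  | cons b t ih =>
    rw [List.nodup_cons] at hl
    rw [List.map_cons, List.prod_cons, ih hl.2]
    by_cases hb : b = j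
    · subst hb
      simp [hl.1]
    · simp [hb, Ne.symm hb]

theorem pathSum_parallel (w : ℕ → ℝ) (G : Network n) (j : Fin n) :
    pathSum w (G.parallel j) =
      ∑ l ∈ G.paths, if j ∈ l then 2 * w l.length else w l.length := by
  classical
  rw [pathSum, ← Finset.sum_fiberwise_of_maps_to (t := G.paths) (g := List.map (origin j))
    (fun l hl => by simpa [isPath_parallel] using hl)]
  refine Finset.sum_congr rfl fun l₀ hl₀ => ?_
  have hcard : ((G.parallel j).paths.filter fun l => l.map (origin j) = l₀).card =
      if j ∈ l₀ then 2 else 1 := by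
    rw [← ncard_setOf_map_origin_eq j (mem_paths.1 hl₀).nodup, ← Set.ncard_coe_finset]
    congr 1
    ext l
    simp only [Finset.coe_filter, mem_paths, isPath_parallel, Set.mem_ofPred_eq, and_iff_right_iff_imp]
    rintro rfl
    exact mem_paths.1 hl₀
  rw [Finset.sum_congr rfl (g := fun _ => w l₀.length), Finset.sum_const, hcard]
  · split_ifs <;> simp
  · intro l hl
    rw [← (Finset.mem_filter.1 hl).2, List.length_map]

theorem sum_pathSum_parallel (w : ℕ → ℝ) (G : Network n) :
    ∑ j, pathSum w (G.parallel j) = pathSum (fun s => (n + s) * w s) G := by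
  simp_rw [pathSum_parallel]
  rw [Finset.sum_comm, pathSum]
  refine Finset.sum_congr rfl fun l hl => ?_
  rw [sum_ite_mem_paths hl]
  ring

/-! ### Serial doubling -/

/-- All nodes of the network have names at most `n`. -/
def NodesLE (G : Network n) : Prop :=
  ∀ e, G.tail e ≤ n ∧ G.head e ≤ n

theorem NodesLE.parallel {G : Network n} (h : G.NodesLE) (j : Fin n) : (G.parallel j).NodesLE := by
  intro e
  have := h (origin j e)
  simp only [parallel_tail, parallel_head, Function.comp_apply]
  omega

theorem serial_tail_castSucc (G : Network n) (j i : Fin n) :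
    (G.serial j).tail i.castSucc = G.tail i := by
  simp [serial]

theorem serial_tail_last (G : Network n) (j : Fin n) :
    (G.serial j).tail (Fin.last n) = n + 1 := by
  simp [serial]

theorem serial_head_castSucc (G : Network n) (j i : Fin n) :
    (G.serial j).head i.castSucc = if i = j then n + 1 else G.head i := by
  simp [serial, Function.update_apply]

theorem serial_head_last (G : Network n) (j : Fin n) :
    (G.serial j).head (Fin.last n) = G.head j := by
  simp only [serial, Fin.snoc_last]

theorem NodesLE.serial {G : Network n} (h : G.NodesLE) (j : Fin n) : (G.serial j).NodesLE := by
  intro e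
  have hj := h j
  refine Fin.lastCases ?_ (fun i => ?_) e
  · rw [serial_tail_last, serial_head_last]
    omega
  · rw [serial_tail_castSucc, serial_head_castSucc]
    have := h i
    split_ifs <;> omega

/-- The path in the serially doubled network that corresponds to a path in the original network. -/
def subdivide (j : Fin n) : List (Fin n) → List (Fin (n + 1))
  | [] => []
  | e :: l => if e = j then e.castSucc :: Fin.last n :: subdivide j l
      else e.castSucc :: subdivide j l

theorem subdivide_injective (j : Fin n) : Function.Injective (subdivide j) := by
  intro l
  induction l with
  | nil =>
    intro l' h
    cases l' with
    | nil => rfl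
    | cons e l' => simp only [subdivide] at h; split_ifs at h
  | cons e l ih =>
    intro l' h
    cases l' with
    | nil => simp only [subdivide] at h; split_ifs at h
    | cons e' l' =>
      simp only [subdivide] at h
      have he : e = e' := by
        split_ifs at h <;> simp_all
      subst he
      split_ifs at h
      · simp only [List.cons.injEq, true_and] at h
        rw [ih h]
      · simp only [List.cons.injEq, true_and] at h
        rw [ih h]

theorem length_subdivide (j : Fin n) {l : List (Fin n)} (hl : l.Nodup) :
    (subdivide j l).length = if j ∈ l then l.length + 1 else l.length := by
  induction l with
  | nil => simp [subdivide]
  | cons e l ih =>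
    rw [List.nodup_cons] at hl
    by_cases he : e = j
    · subst he
      simp [subdivide, ih hl.2, hl.1]
    · simp only [subdivide, he, if_false, List.length_cons, ih hl.2, List.mem_cons, Ne.symm he,
        false_or]
      split_ifs <;> rfl

theorem isWalk_subdivide (G : Network n) (j : Fin n) (l : List (Fin n)) (x y : ℕ) :
    (G.serial j).IsWalk x (subdivide j l) y ↔ G.IsWalk x l y := by
  induction l generalizing x with
  | nil => rfl
  | cons e l ih =>
    by_cases he : e = j
    · simp [subdivide, he, IsWalk, ih, serial_tail_castSucc, serial_tail_last,
        serial_head_castSucc, serial_head_last]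
    · simp [subdivide, he, IsWalk, ih, serial_tail_castSucc, serial_head_castSucc]

/-- Because the node `n + 1` is new, only the shortened edge `j` enters it and only the last edge
leaves it, so a walk between old nodes takes these two edges consecutively. The induction is on a
bound for the length, since one step may remove two edges. -/
theorem NodesLE.exists_eq_subdivide {G : Network n} (h : G.NodesLE) (j : Fin n) {y : ℕ}
    (hy : y ≤ n) (N : ℕ) (l : List (Fin (n + 1))) (hl : l.length ≤ N) (x : ℕ) (hx : x ≤ n)
    (hw : (G.serial j).IsWalk x l y) : ∃ l₀, l = subdivide j l₀ := by
  induction N generalizing l x with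
  | zero => exact ⟨[], by simpa [subdivide] using hl⟩
  | succ N ih =>
    cases l with
    | nil => exact ⟨[], rfl⟩
    | cons e l =>
      rw [List.length_cons] at hl
      obtain ⟨h1, h2⟩ := hw
      revert h1 h2
      refine Fin.lastCases (fun h1 _ => ?_) (fun i h1 h2 => ?_) e
      · rw [serial_tail_last] at h1
        omega
      · rw [serial_head_castSucc] at h2
        by_cases hi : i = j
        · rw [if_pos hi] at h2
          cases l with
          | nil =>
            have : n + 1 = y := h2
            omega
          | cons e' l' =>
            rw [List.length_cons] at hl
            obtain ⟨h3, h4⟩ := h2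
            revert h3 h4
            refine Fin.lastCases (fun h3 h4 => ?_) (fun i' h3 _ => ?_) e'
            · rw [serial_head_last] at h4
              obtain ⟨l₀, rfl⟩ := ih l' (by omega) _ (h j).2 h4
              exact ⟨i :: l₀, by simp [subdivide, hi]⟩
            · rw [serial_tail_castSucc] at h3
              have := (h i').1
              omega
        · rw [if_neg hi] at h2
          obtain ⟨l₀, rfl⟩ := ih l (by omega) _ (h i).2 h2
          exact ⟨i :: l₀, by simp [subdivide, hi]⟩

theorem mem_map_head_subdivide (G : Network n) (j : Fin n) (l : List (Fin n)) (v : ℕ) :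
    v ∈ (subdivide j l).map (G.serial j).head ↔ v ∈ l.map G.head ∨ v = n + 1 ∧ j ∈ l := by
  induction l with
  | nil => simp [subdivide]
  | cons e l ih =>
    by_cases he : e = j
    · subst he
      simp only [subdivide, if_true, List.map_cons, List.mem_cons, ih, serial_head_castSucc,
        serial_head_last, true_or, and_true]
      tauto
    · simp only [subdivide, he, if_false, List.map_cons, List.mem_cons, ih, serial_head_castSucc,
        Ne.symm he, false_or]
      tauto

theorem NodesLE.nodup_map_head_subdivide {G : Network n} (h : G.NodesLE) (j : Fin n)
    (l : List (Fin n)) :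
    ((subdivide j l).map (G.serial j).head).Nodup ↔ (l.map G.head).Nodup := by
  have hz : ∀ l : List (Fin n), n + 1 ∉ l.map G.head := by
    intro l hl
    obtain ⟨e, -, he⟩ := List.mem_map.1 hl
    have := (h e).2
    omega
  induction l with
  | nil => simp [subdivide]
  | cons e l ih =>
    have he' := (h e).2
    by_cases he : e = j
    · subst he
      simp only [subdivide, if_true, List.map_cons, List.nodup_cons, List.mem_cons, ih,
        serial_head_castSucc, serial_head_last, mem_map_head_subdivide, hz, true_and, false_or]
      constructor
      · rintro ⟨-, h2, h3⟩
        exact ⟨fun h4 => h2 (Or.inl h4), h3⟩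
      · rintro ⟨h2, h3⟩
        refine ⟨?_, ?_, h3⟩
        · rintro (h4 | h4)
          · omega
          · exact h2 (List.mem_map_of_mem h4)
        · rintro (h4 | ⟨h4, -⟩)
          · exact h2 h4
          · omega
    · simp only [subdivide, he, if_false, List.map_cons, List.nodup_cons, ih,
        serial_head_castSucc, mem_map_head_subdivide]
      have : G.head e ≠ n + 1 := by omega
      simp [this]

theorem NodesLE.isPath_subdivide {G : Network n} (h : G.NodesLE) (j : Fin n) (l : List (Fin n))
    {x : ℕ} (hx : x ≤ n) (y : ℕ) :
    (G.serial j).IsPath x (subdivide j l) y ↔ G.IsPath x l y := by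
  rw [IsPath, IsPath, isWalk_subdivide, List.nodup_cons, List.nodup_cons,
    h.nodup_map_head_subdivide, mem_map_head_subdivide]
  have : x ≠ n + 1 := by omega
  simp [this]

theorem NodesLE.pathSum_serial (w : ℕ → ℝ) {G : Network n} (h : G.NodesLE) (hn : 1 ≤ n)
    (j : Fin n) :
    pathSum w (G.serial j) =
      ∑ l ∈ G.paths, if j ∈ l then w (l.length + 1) else w l.length := by
  classical
  have himg : (G.serial j).paths = G.paths.image (subdivide j) := by
    ext l
    simp only [mem_paths, Finset.mem_image]
    constructor
    · intro hl
      obtain ⟨l₀, rfl⟩ := h.exists_eq_subdivide j hn l.length l le_rfl source (Nat.zero_le _) hl.1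
      exact ⟨l₀, (h.isPath_subdivide j l₀ (Nat.zero_le _) _).1 hl, rfl⟩
    · rintro ⟨l₀, hl₀, rfl⟩
      exact (h.isPath_subdivide j l₀ (Nat.zero_le _) _).2 hl₀
  rw [pathSum, himg, Finset.sum_image ((subdivide_injective j).injOn)]
  refine Finset.sum_congr rfl fun l hl => ?_
  rw [length_subdivide j (mem_paths.1 hl).nodup]
  split_ifs <;> rfl

theorem NodesLE.sum_pathSum_serial (w : ℕ → ℝ) {G : Network n} (h : G.NodesLE) (hn : 1 ≤ n) :
    ∑ j, pathSum w (G.serial j) = pathSum (fun s => s * w (s + 1) + (n - s) * w s) G := by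
  simp_rw [h.pathSum_serial w hn]
  rw [Finset.sum_comm, pathSum]
  exact Finset.sum_congr rfl fun l hl => sum_ite_mem_paths hl _ _

theorem numPaths_eq_pathSum (G : Network n) : (G.numPaths : ℝ) = pathSum (fun _ => 1) G := by
  simp [pathSum, numPaths_eq_card_paths]

theorem paths_single : single.paths = {[0]} := by
  ext l
  simp only [mem_paths, Finset.mem_singleton]
  constructor
  · intro h
    have h1 := length_le_of_mem_paths (mem_paths.2 h)
    have h2 := length_pos_of_mem_paths (mem_paths.2 h)
    obtain ⟨e, rfl⟩ := List.length_eq_one_iff.1 (le_antisymm h1 h2)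
    rw [Subsingleton.elim e 0]
  · rintro rfl
    simp [IsPath, IsWalk, single, source, sink]

theorem nodesLE_single : single.NodesLE := by
  intro e
  simp [single, source, sink]

/-- There are infinitely many networks with `n` edges, as node names are arbitrary, but all their
paths lie in the one finite set of duplicate-free lists. The uniform bound gives every integrability
statement below. -/
theorem abs_pathSum_le (w : ℕ → ℝ) (n : ℕ) : ∃ C, ∀ G : Network n, |pathSum w G| ≤ C := by
  refine ⟨∑ l ∈ (finite_setOf_nodup n).toFinset, |w l.length|, fun G => ?_⟩
  refine (Finset.abs_sum_le_sum_abs _ _).trans ?_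
  refine Finset.sum_le_sum_of_subset_of_nonneg (fun l hl => ?_) fun _ _ _ => abs_nonneg _
  simpa using (mem_paths.1 hl).nodup

end Network

/-! ### Expectations in the Bernoulli model -/

theorem PMF.toMeasure_bind_of_fintype {α β : Type*} [Fintype α] [MeasurableSpace β] (p : PMF α)
    (f : α → PMF β) : (p.bind f).toMeasure = ∑ a, p a • (f a).toMeasure := by
  ext s hs
  rw [PMF.toMeasure_bind_apply _ _ _ hs, tsum_fintype]
  simp

theorem toReal_coin_apply (p : unitInterval) (b : Bool) :
    (coin p b).toReal = if b then (p : ℝ) else 1 - p := by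
  classical
  rw [coin, Measure.toPMF_apply]
  exact (bernoulliMeasure_real_apply p (measurableSet_singleton b)).trans (by cases b <;> simp)

namespace Network

theorem integrable_pathSum (w : ℕ → ℝ) {n : ℕ} (μ : Measure (Network n)) [IsFiniteMeasure μ] :
    Integrable (pathSum w) μ := by
  obtain ⟨C, hC⟩ := abs_pathSum_le w n
  exact Integrable.of_bound (Measurable.of_discrete).aestronglyMeasurable C
    (Eventually.of_forall hC)

end Network

open Network

theorem nodesLE_of_mem_support_bernoulliNetwork (p : unitInterval) (m : ℕ) :
    ∀ G ∈ (bernoulliNetwork p m).support, G.NodesLE := by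
  induction m with
  | zero =>
    intro G hG
    simp only [bernoulliNetwork, PMF.support_pure, Set.mem_singleton_iff] at hG
    exact hG ▸ nodesLE_single
  | succ m ih =>
    intro G hG
    simp only [bernoulliNetwork, bernoulliStep, PMF.mem_support_bind_iff, PMF.mem_support_map_iff] at hG
    obtain ⟨G', hG', j, -, b, -, rfl⟩ := hG
    split_ifs
    · exact (ih G' hG').parallel j
    · exact (ih G' hG').serial j

theorem ae_nodesLE_bernoulliNetwork (p : unitInterval) (m : ℕ) :
    ∀ᵐ G ∂(bernoulliNetwork p m).toMeasure, G.NodesLE := by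
  rw [ae_iff, PMF.toMeasure_apply_eq_zero_iff _ (MeasurableSet.of_discrete)]
  exact Set.disjoint_left.2 fun G hG hG' => hG' (nodesLE_of_mem_support_bernoulliNetwork p m G hG)

/-- The laws of the edge and of the coin do not depend on the current network, so they can be drawn
first; the integral becomes a finite sum over edge and coin. -/
theorem integral_bernoulliNetwork_succ (p : unitInterval) (m : ℕ) (φ : Network (m + 2) → ℝ)
    {C : ℝ} (hφ : ∀ G, |φ G| ≤ C) :
    ∫ G, φ G ∂(bernoulliNetwork p (m + 1)).toMeasure =
      ∑ j, 1 / (m + 1 : ℝ) *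
        (p * ∫ G, φ (G.parallel j) ∂(bernoulliNetwork p m).toMeasure +
        (1 - p) * ∫ G, φ (G.serial j) ∂(bernoulliNetwork p m).toMeasure) := by
  have hint : ∀ (n : ℕ) (μ : Measure (Network n)) [IsFiniteMeasure μ] (g : Network n → Network (m + 2)),
      Integrable (fun G => φ (g G)) μ := fun n μ _ g =>
    Integrable.of_bound (Measurable.of_discrete).aestronglyMeasurable C
      (Eventually.of_forall fun G => hφ (g G))
  have h : bernoulliNetwork p (m + 1) = (PMF.uniformOfFintype (Fin (m + 1))).bind fun j =>
      (coin p).bind fun b => (bernoulliNetwork p m).map fun G =>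
        if b then G.parallel j else G.serial j := by
    rw [bernoulliNetwork]
    unfold bernoulliStep
    rw [PMF.bind_comm]
    congr 1
    funext j
    simp only [PMF.map]
    rw [PMF.bind_comm]
    rfl
  rw [h, PMF.toMeasure_bind_of_fintype, integral_finsetSum_measure]
  · refine Finset.sum_congr rfl fun j _ => ?_
    rw [integral_smul_measure, PMF.toMeasure_bind_of_fintype, integral_finsetSum_measure]
    · have hmap : ∀ g : Network (m + 1) → Network (m + 2),
          ∫ G, φ G ∂((bernoulliNetwork p m).map g).toMeasure =
            ∫ G, φ (g G) ∂(bernoulliNetwork p m).toMeasure := fun g => by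
        rw [← PMF.toMeasure_map g (bernoulliNetwork p m) Measurable.of_discrete,
          integral_map Measurable.of_discrete.aemeasurable
            Measurable.of_discrete.aestronglyMeasurable]
      rw [Fintype.sum_bool, integral_smul_measure, integral_smul_measure, hmap, hmap]
      have hm : (m + 1 : ENNReal).toReal = m + 1 := by
        exact_mod_cast ENNReal.toReal_natCast (m + 1)
      simp [toReal_coin_apply, hm]
    · intro b _
      exact (hint _ _ id).smul_measure (PMF.apply_ne_top _ _)
  · intro j _
    exact (hint _ _ id).smul_measure (PMF.apply_ne_top _ _)

/-- The expectation of a sum over all paths of a weight that depends on the length. -/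
noncomputable def expectedPathSum (p : unitInterval) (m : ℕ) (w : ℕ → ℝ) : ℝ :=
  ∫ G, pathSum w G ∂(bernoulliNetwork p m).toMeasure

theorem expectedPathSum_zero (p : unitInterval) (w : ℕ → ℝ) : expectedPathSum p 0 w = w 1 := by
  simp only [expectedPathSum, bernoulliNetwork, PMF.toMeasure_pure]
  rw [integral_dirac]
  simp [pathSum, paths_single]

/-- The growth step acts by duality on weights: the new weight again depends only on the length, so
the system closes. -/
theorem expectedPathSum_succ (p : unitInterval) (m : ℕ) (w : ℕ → ℝ) :
    (m + 1) * expectedPathSum p (m + 1) w = expectedPathSum p m fun s =>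
      p * ((m + 1 + s) * w s) + (1 - p) * (s * w (s + 1) + (m + 1 - s) * w s) := by
  obtain ⟨C, hC⟩ := abs_pathSum_le w (m + 2)
  have hint : ∀ g : Network (m + 1) → Network (m + 2),
      Integrable (fun G => pathSum w (g G)) (bernoulliNetwork p m).toMeasure := fun g =>
    Integrable.of_bound (Measurable.of_discrete).aestronglyMeasurable C
      (Eventually.of_forall fun G => hC (g G))
  rw [expectedPathSum, integral_bernoulliNetwork_succ p m _ hC, ← Finset.mul_sum, ← mul_assoc,
    mul_one_div_cancel (by positivity), one_mul, Finset.sum_add_distrib, ← Finset.mul_sum,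
    ← Finset.mul_sum, ← integral_finsetSum _ fun j _ => hint _,
    ← integral_finsetSum _ fun j _ => hint _, ← integral_const_mul, ← integral_const_mul,
    ← integral_add ((integrable_finsetSum _ fun j _ => hint _).const_mul _)
      ((integrable_finsetSum _ fun j _ => hint _).const_mul _), expectedPathSum]
  refine integral_congr_ae ?_
  filter_upwards [ae_nodesLE_bernoulliNetwork p m] with G hG
  rw [sum_pathSum_parallel, hG.sum_pathSum_serial w (by omega)]
  simp only [pathSum, Finset.mul_sum, ← Finset.sum_add_distrib]
  push_cast
  rfl

/-- The expected number of source-to-sink paths of length `s` in a network with `m + 1` edges. -/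
noncomputable def expectedPathsOfLength (p : unitInterval) (m s : ℕ) : ℝ :=
  expectedPathSum p m fun k => if k = s then 1 else 0

theorem expectedPathsOfLength_zero (p : unitInterval) (s : ℕ) :
    expectedPathsOfLength p 0 (s + 1) = if s = 0 then 1 else 0 := by
  simp [expectedPathsOfLength, expectedPathSum_zero]

theorem expectedPathSum_linear (p : unitInterval) (m : ℕ) (a b : ℝ) (w v : ℕ → ℝ) :
    expectedPathSum p m (fun s => a * w s + b * v s) =
      a * expectedPathSum p m w + b * expectedPathSum p m v := by
  simp only [expectedPathSum, ← integral_const_mul]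
  rw [← integral_add ((integrable_pathSum w _).const_mul a) ((integrable_pathSum v _).const_mul b)]
  simp only [pathSum, Finset.mul_sum, ← Finset.sum_add_distrib]

theorem expectedPathsOfLength_succ (p : unitInterval) (m s : ℕ) :
    (m + 1) * expectedPathsOfLength p (m + 1) (s + 1) =
      (m + 1 + (2 * p - 1) * (s + 1)) * expectedPathsOfLength p m (s + 1) +
        (1 - p) * s * expectedPathsOfLength p m s := by
  rw [expectedPathsOfLength, expectedPathSum_succ, expectedPathsOfLength, expectedPathsOfLength,
    ← expectedPathSum_linear]
  congr 1
  funext k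
  by_cases h1 : k = s + 1
  · subst h1
    simp
    ring
  · by_cases h2 : k = s
    · subst h2
      simp
    · simp [h1, h2]

theorem expectedPaths_succ (p : unitInterval) (m : ℕ) :
    expectedPaths p (m + 1) = ∑ s ∈ Finset.range (m + 1), expectedPathsOfLength p m (s + 1) := by
  simp only [expectedPaths, expectedPathsOfLength, expectedPathSum]
  rw [← integral_finsetSum _ fun s _ => integrable_pathSum _ _]
  congr 1
  funext G
  rw [numPaths_eq_pathSum]
  simp only [pathSum]
  rw [Finset.sum_comm]
  refine Finset.sum_congr rfl fun l hl => ?_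
  have h1 := length_le_of_mem_paths hl
  have h2 := length_pos_of_mem_paths hl
  rw [Finset.sum_eq_single (l.length - 1)]
  · rw [if_pos (by omega)]
  · intro s _ hs
    rw [if_neg (by omega)]
  · intro hs
    exact absurd (Finset.mem_range.2 (by omega)) hs

theorem integrable_numPaths (p : unitInterval) (m : ℕ) :
    Integrable (fun G : Network (m + 1) => (G.numPaths : ℝ)) (bernoulliNetwork p m).toMeasure := by
  simp only [numPaths_eq_pathSum]
  exact integrable_pathSum _ _

/-! ### Binomial series, antiderivatives and geometric series -/

namespace PowerSeries

/-- The dictionary between the differential equations and the coefficient recurrences used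
throughout. -/
theorem coeff_one_sub_X_mul_derivative {R : Type*} [CommRing R] (f : R⟦X⟧) (m : ℕ) :
    coeff m ((1 - X) * d⁄dX R f) = (m + 1) * coeff (m + 1) f - m * coeff m f := by
  rw [sub_mul, one_mul, map_sub, coeff_derivative]
  cases m with
  | zero => simp
  | succ m =>
    rw [coeff_succ_X_mul, coeff_derivative]
    push_cast
    ring

/-- The tail of the geometric series is divisible by `X ^ (m + 1)`, so it does not reach the
coefficient of `X ^ m`. -/
theorem coeff_mul_inv_one_sub {k : Type*} [Field k] (f : k⟦X⟧) {W : k⟦X⟧}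
    (hW : constantCoeff W = 0) (m : ℕ) :
    coeff m (f * (1 - W)⁻¹) = ∑ i ∈ Finset.range (m + 1), coeff m (f * W ^ i) := by
  have h1 : (1 - W) * (1 - W)⁻¹ = 1 := PowerSeries.mul_inv_cancel _ (by simp [hW])
  have h2 : f * (1 - W)⁻¹ =
      ∑ i ∈ Finset.range (m + 1), f * W ^ i + W ^ (m + 1) * (f * (1 - W)⁻¹) := by
    have h3 := mul_neg_geom_sum W (m + 1)
    rw [← Finset.mul_sum]
    linear_combination (f * ∑ i ∈ Finset.range (m + 1), W ^ i) * h1 - f * (1 - W)⁻¹ * h3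
  obtain ⟨U, hU⟩ := pow_dvd_pow_of_dvd (X_dvd_iff.2 hW) (m + 1)
  rw [h2, map_add, map_sum, hU, mul_assoc, coeff_X_pow_mul', if_neg (by omega), add_zero]

/-- The binomial series `(1 - X) ^ b`. -/
noncomputable def oneSubPow (b : ℝ) : ℝ⟦X⟧ :=
  rescale (-1) (binomialSeries ℝ b)

theorem coeff_oneSubPow (b : ℝ) (n : ℕ) :
    coeff n (oneSubPow b) = (-1) ^ n * Ring.choose b n := by
  simp [oneSubPow, coeff_rescale]

theorem constantCoeff_oneSubPow (b : ℝ) : constantCoeff (oneSubPow b) = 1 := by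
  rw [← coeff_zero_eq_constantCoeff_apply, coeff_oneSubPow]
  simp

theorem oneSubPow_add (b c : ℝ) : oneSubPow (b + c) = oneSubPow b * oneSubPow c := by
  simp [oneSubPow]

theorem oneSubPow_zero : oneSubPow 0 = 1 := by
  simp [oneSubPow]

theorem oneSubPow_one : oneSubPow 1 = 1 - X := by
  have := binomialSeries_nat (R := ℝ) (A := ℝ) 1
  rw [oneSubPow, ← Nat.cast_one, this]
  simp [rescale_X, sub_eq_add_neg]

theorem oneSubPow_mul_natCast (b : ℝ) (k : ℕ) : oneSubPow (b * k) = oneSubPow b ^ k := by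
  induction k with
  | zero => simp [oneSubPow_zero]
  | succ k ih => rw [pow_succ, ← ih, ← oneSubPow_add]; push_cast; ring_nf

theorem coeff_succ_oneSubPow (b : ℝ) (n : ℕ) :
    (n + 1) * coeff (n + 1) (oneSubPow b) = (n - b) * coeff n (oneSubPow b) := by
  have h : (n + 1) * Ring.choose b (n + 1) = (b - n) * Ring.choose b n := by
    have := Ring.choose_eq_smul (a := b) (n := n + 1)
    have h' := Ring.choose_eq_smul (a := b) (n := n)
    rw [this, h', descPochhammer_succ_right, Nat.factorial_succ]
    simp [Polynomial.smeval_mul, Polynomial.smeval_sub, Polynomial.smeval_X, Polynomial.smeval_natCast]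
    have : ((n:ℝ)+1) ≠ 0 := by positivity
    field_simp
  rw [coeff_oneSubPow, coeff_oneSubPow, pow_succ]
  linear_combination -(-1) ^ n * h

theorem one_sub_X_mul_derivative_oneSubPow (b : ℝ) :
    (1 - X) * d⁄dX ℝ (oneSubPow b) = -b • oneSubPow b := by
  ext m
  rw [coeff_one_sub_X_mul_derivative, coeff_succ_oneSubPow]
  simp
  ring

theorem coeff_oneSubPow_eq_prod (b : ℝ) (n : ℕ) :
    coeff n (oneSubPow b) = ∏ j ∈ Finset.range n, (1 - (b + 1) / (j + 1)) := by
  induction n with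
  | zero => simp [constantCoeff_oneSubPow]
  | succ n ih =>
    rw [Finset.prod_range_succ, ← ih]
    have h := coeff_succ_oneSubPow b n
    have : ((n:ℝ)+1) ≠ 0 := by positivity
    field_simp
    linear_combination h

/-- The formal antiderivative without constant term. -/
noncomputable def antideriv (f : ℝ⟦X⟧) : ℝ⟦X⟧ :=
  mk fun n => coeff (n - 1) f / n

theorem constantCoeff_antideriv (f : ℝ⟦X⟧) : constantCoeff (antideriv f) = 0 := by
  rw [← coeff_zero_eq_constantCoeff_apply, antideriv, coeff_mk]
  simp

theorem derivative_antideriv (f : ℝ⟦X⟧) : d⁄dX ℝ (antideriv f) = f := by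
  ext n
  have : ((n:ℝ)+1) ≠ 0 := by positivity
  rw [coeff_derivative, antideriv, coeff_mk]
  rw [Nat.add_sub_cancel, Nat.cast_succ]
  field_simp

theorem one_sub_X_mul_oneSubPow_eq (b : ℝ) :
    (1 - X) * oneSubPow b = 1 + (-b - 1) • antideriv (oneSubPow b) := by
  refine derivative.ext ?_ (by simp [constantCoeff_oneSubPow, constantCoeff_antideriv])
  rw [Derivation.leibniz, smul_eq_mul, smul_eq_mul, one_sub_X_mul_derivative_oneSubPow, map_add,
    Derivation.map_smul, derivative_antideriv, map_sub, derivative_one, derivative_X]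
  rw [sub_smul]
  simp
  ring

end PowerSeries

open PowerSeries

/-- Both sides obey the same recursion in `m`: the products on the right satisfy a differential
equation because `(1 - X) f' = 2p f` and `(1 - X) f = 1 + (2p - 1) V`. -/
theorem expectedPathsOfLength_eq_coeff (p : unitInterval) (m l : ℕ) :
    expectedPathsOfLength p m (l + 1) =
      coeff m (oneSubPow (-(2 * p)) * ((1 - p : ℝ) • antideriv (oneSubPow (-(2 * p)))) ^ l) := by
  set f := oneSubPow (-(2 * p)) with hf
  set V := antideriv f with hV
  -- For `l = 0` the truncated exponent `l - 1` is harmless, as its term carries the factor `l`.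
  have hode : ∀ l : ℕ, (1 - X) * d⁄dX ℝ (f * ((1 - p : ℝ) • V) ^ l) =
      (2 * p + (2 * p - 1) * l : ℝ) • (f * ((1 - p : ℝ) • V) ^ l) +
        ((1 - p) * l : ℝ) • (f * ((1 - p : ℝ) • V) ^ (l - 1)) := by
    intro l
    have h1 := one_sub_X_mul_derivative_oneSubPow (-(2 * p))
    have h2 := one_sub_X_mul_oneSubPow_eq (-(2 * p))
    rw [← hf] at h1 h2
    rw [← hV] at h2
    rw [Derivation.leibniz, derivative_pow, Derivation.map_smul, derivative_antideriv]
    simp only [smul_eq_C_mul, smul_eq_mul] at h1 h2 ⊢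
    cases l with
    | zero => simp at h1 ⊢; linear_combination h1
    | succ l =>
      simp only [Nat.add_sub_cancel, map_add, map_sub, map_mul, map_neg, map_one, map_natCast,
        map_ofNat, Nat.cast_add, Nat.cast_one] at h1 h2 ⊢
      linear_combination (((1 - C (p : ℝ)) * V) ^ (l + 1)) * h1 +
        f * ((l + 1) * ((1 - C (p : ℝ)) * V) ^ l * (1 - C (p : ℝ))) * h2
  induction m generalizing l with
  | zero =>
    rw [expectedPathsOfLength_zero, coeff_zero_eq_constantCoeff_apply]
    simp [hf, hV, constantCoeff_oneSubPow, constantCoeff_antideriv, zero_pow_eq]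
  | succ m ih =>
    have hm : (m + 1 : ℝ) ≠ 0 := by positivity
    have h1 := congrArg (coeff m) (hode l)
    rw [coeff_one_sub_X_mul_derivative, map_add, coeff_smul, coeff_smul] at h1
    have h2 := expectedPathsOfLength_succ p m l
    refine mul_left_cancel₀ hm ?_
    rw [h2, ih]
    cases l with
    | zero => simp at h1 ⊢; linear_combination -h1
    | succ l =>
      rw [ih]
      simp only [Nat.add_sub_cancel, smul_eq_mul] at h1
      push_cast at h1 ⊢
      linear_combination -h1

theorem expectedPaths_eq_coeff (p : unitInterval) (m : ℕ) :
    expectedPaths p (m + 1) = coeff m (oneSubPow (-(2 * p)) *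
      (1 - (1 - p : ℝ) • antideriv (oneSubPow (-(2 * p))))⁻¹) := by
  rw [coeff_mul_inv_one_sub _ (by simp [constantCoeff_antideriv]), expectedPaths_succ]
  exact Finset.sum_congr rfl fun l _ => expectedPathsOfLength_eq_coeff p m l

/-- For `p ≠ 1/2` the relation `(1 - X) f = 1 + (2p - 1) V` eliminates `V`; numerator and
denominator are multiplied by `(1 - X) ^ (2p - 1)`. -/
theorem expectedPaths_eq_coeff_of_ne_half (p : unitInterval) (hp : (p : ℝ) ≠ 1 / 2) (m : ℕ) :
    expectedPaths p (m + 1) = coeff m (oneSubPow (-1) *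
      (1 - (p / (2 * p - 1) : ℝ) • (1 - oneSubPow (2 * p - 1)))⁻¹) := by
  have hs : (2 * p - 1 : ℝ) ≠ 0 := fun h => hp (by linarith)
  rw [expectedPaths_eq_coeff]
  congr 1
  have h2 := one_sub_X_mul_oneSubPow_eq (-(2 * p))
  have h3 : (1 - X) * oneSubPow (-(2 * p)) * oneSubPow (2 * p - 1) = 1 := by
    rw [← oneSubPow_one, ← oneSubPow_add, ← oneSubPow_add, ← oneSubPow_zero]
    ring_nf
  have h4 : oneSubPow (-(2 * p)) * oneSubPow (2 * p - 1) = oneSubPow (-1) := by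
    rw [← oneSubPow_add]
    ring_nf
  set f := oneSubPow (-(2 * p))
  set V := antideriv f with hV
  set u := oneSubPow (2 * p - 1) with hu
  have hC : C (p / (2 * p - 1) : ℝ) * C (2 * p - 1 : ℝ) = C (p : ℝ) := by
    rw [← map_mul, div_mul_cancel₀ _ hs]
  have hC0 : (C (2 * p - 1 : ℝ) : ℝ⟦X⟧) ≠ 0 := (map_ne_zero_iff _ C_injective).2 hs
  have hC' : (C (2 * p - 1 : ℝ) : ℝ⟦X⟧) = 2 * C (p : ℝ) - 1 := by
    rw [show (2 * p - 1 : ℝ) = p + p - 1 by ring, map_sub, map_add, map_one]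
    ring
  have hu0 : u * u⁻¹ = 1 := PowerSeries.mul_inv_cancel _ (by simp [hu, constantCoeff_oneSubPow])
  simp only [smul_eq_C_mul, neg_neg] at h2 ⊢
  have hC1 : (C (1 - p : ℝ) : ℝ⟦X⟧) = 1 - C (p : ℝ) := by simp
  have key : 1 - C (p / (2 * p - 1) : ℝ) * (1 - u) = u * (1 - C (1 - p : ℝ) * V) := by
    refine mul_left_cancel₀ hC0 ?_
    have h5 : u * C (2 * p - 1 : ℝ) * V = 1 - u := by
      linear_combination h3 - u * h2
    rw [hC1]
    linear_combination (u - 1) * hC + (1 - C (p : ℝ)) * h5 + (1 - u) * hC'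
  rw [← h4, key, PowerSeries.mul_inv_rev]
  linear_combination -f * (1 - C (1 - p : ℝ) * V)⁻¹ * hu0

theorem expectedPaths_eq_sum_choose (p : unitInterval) (hp : (p : ℝ) ≠ 1 / 2) (n : ℕ)
    (hn : 1 ≤ n) :
    expectedPaths p n = ∑ j ∈ Finset.range n, (-1 : ℝ) ^ (n + j - 1) *
      Ring.choose ((2 * p - 1) * (j : ℝ) - 1) (n - 1) *
      ∑ k ∈ Finset.range n, (k.choose j : ℝ) * (p / (2 * p - 1)) ^ k := by
  obtain ⟨m, rfl⟩ := Nat.exists_eq_add_of_le' hn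
  rw [expectedPaths_eq_coeff_of_ne_half p hp,
    coeff_mul_inv_one_sub _ (by simp [constantCoeff_oneSubPow])]
  simp_rw [Finset.mul_sum]
  rw [Finset.sum_comm]
  refine Finset.sum_congr rfl fun k hk => ?_
  -- The binomial expansion is padded by zero terms with `j > k`, so that the range of `j` does not
  -- depend on `k`.
  have hexp : (1 - oneSubPow (2 * p - 1)) ^ k =
      ∑ j ∈ Finset.range (m + 1), ((-1) ^ j * k.choose j : ℝ) • oneSubPow ((2 * p - 1) * j) := by
    rw [sub_eq_neg_add, add_pow]
    refine Finset.sum_subset_zero_on_sdiff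
      (Finset.range_subset_range.2 (Nat.succ_le_of_lt (Finset.mem_range.1 hk))) ?_ ?_
    · intro j hj
      rw [Finset.mem_sdiff, Finset.mem_range, Finset.mem_range] at hj
      rw [Nat.choose_eq_zero_of_lt (by omega)]
      simp
    · intro j _
      rw [oneSubPow_mul_natCast, smul_eq_C_mul, neg_pow]
      simp
      ring
  rw [smul_pow, hexp, mul_smul_comm, Finset.mul_sum, coeff_smul, map_sum, Finset.smul_sum]
  refine Finset.sum_congr rfl fun j _ => ?_
  rw [mul_smul_comm, ← oneSubPow_add, coeff_smul, coeff_oneSubPow,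
    show m + 1 + j - 1 = m + j by omega, Nat.add_sub_cancel, pow_add, smul_eq_mul, smul_eq_mul,
    neg_add_eq_sub]
  ring

/-! ### Powers of the logarithm, harmonic numbers and Bell polynomials -/

namespace PowerSeries

/-- The power series `∏ (1 - X / j)`, the product being over `1 ≤ j ≤ n`. -/
noncomputable def harmonicProd (n : ℕ) : ℝ⟦X⟧ :=
  ∏ j ∈ Finset.range n, (1 - C (1 / (j + 1) : ℝ) * X)

theorem constantCoeff_harmonicProd (n : ℕ) : constantCoeff (harmonicProd n) = 1 := by
  simp [harmonicProd, map_prod]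

/-- Here `-antideriv (oneSubPow (-1))` is `log (1 - X)`. In passing from `n` to `n + 1`, the
differential equation of the left side matches multiplication of the product by `1 - X / (n + 1)`.
-/
theorem coeff_mul_antideriv_neg_pow (n k : ℕ) :
    coeff n (oneSubPow (-1) * (-antideriv (oneSubPow (-1))) ^ k) =
      k.factorial * coeff k (harmonicProd n) := by
  set f := oneSubPow (-1) with hf
  set V := antideriv f with hV
  have hode : ∀ k : ℕ, (1 - X) * d⁄dX ℝ (f * (-V) ^ k) = f * (-V) ^ k -
      (k : ℝ) • (f * (-V) ^ (k - 1)) := by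
    intro k
    have h1 := one_sub_X_mul_derivative_oneSubPow (-1)
    have h2 : (1 - X) * f = 1 := by
      rw [hf, ← oneSubPow_one, ← oneSubPow_add, ← oneSubPow_zero]
      norm_num
    rw [← hf] at h1
    rw [Derivation.leibniz, derivative_pow, map_neg, derivative_antideriv]
    simp only [smul_eq_C_mul, smul_eq_mul, map_natCast, neg_neg, map_one] at h1 ⊢
    linear_combination (-V) ^ k * h1 - f * k * (-V) ^ (k - 1) * h2
  induction n generalizing k with
  | zero =>
    cases k with
    | zero => simp [hf, harmonicProd, constantCoeff_oneSubPow]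
    | succ k => simp [hV, harmonicProd, constantCoeff_antideriv, coeff_one]
  | succ n ih =>
    have hn : (n + 1 : ℝ) ≠ 0 := by positivity
    have h1 := congrArg (coeff n) (hode k)
    rw [coeff_one_sub_X_mul_derivative, map_sub, coeff_smul, ih, ih, smul_eq_mul] at h1
    have h2 : coeff k (harmonicProd (n + 1)) =
        coeff k (harmonicProd n) - coeff k (C (1 / (n + 1) : ℝ) * (X * harmonicProd n)) := by
      rw [harmonicProd, Finset.prod_range_succ, ← harmonicProd, ← map_sub]
      congr 1
      ring
    rw [h2, coeff_C_mul]
    refine mul_left_cancel₀ hn ?_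
    cases k with
    | zero => simp at h1 ⊢; exact Or.inl (mul_left_cancel₀ hn (by linear_combination h1))
    | succ k =>
      rw [coeff_succ_X_mul]
      rw [Nat.add_sub_cancel, Nat.factorial_succ] at h1
      rw [Nat.factorial_succ]
      push_cast at h1 ⊢
      field_simp
      linear_combination h1

/-- The logarithmic derivative is additive over the factors, and `1 - X / j` contributes the
geometric series with coefficients `-1 / j ^ (m + 1)`. -/
theorem derivative_harmonicProd (n : ℕ) :
    d⁄dX ℝ (harmonicProd n) =
      harmonicProd n * mk fun m => -harmonicNumber (m + 1) n := by
  induction n with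
  | zero =>
    have : (mk fun m => -harmonicNumber (m + 1) 0) = (0 : ℝ⟦X⟧) := by
      ext m
      simp [harmonicNumber]
    rw [this]
    simp [harmonicProd]
  | succ n ih =>
    set c : ℝ := 1 / (n + 1) with hc
    have h1 : harmonicProd (n + 1) = harmonicProd n * (1 - C c * X) := by
      rw [harmonicProd, Finset.prod_range_succ, ← harmonicProd]
    have h2 : (mk fun m => -harmonicNumber (m + 1) (n + 1)) =
        (mk fun m => -harmonicNumber (m + 1) n) - mk fun m => c ^ (m + 1) := by
      ext m
      simp only [harmonicNumber, Finset.sum_Icc_succ_top (Nat.le_add_left 1 n), coeff_mk, map_sub,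
        hc, one_div, inv_pow]
      push_cast
      ring
    have h3 : (1 - C c * X) * (mk fun m => c ^ (m + 1)) = C c := by
      ext m
      rw [sub_mul, one_mul, map_sub, mul_assoc, coeff_C_mul]
      cases m with
      | zero => simp
      | succ m => simp [coeff_succ_X_mul]; ring
    rw [h1, h2, Derivation.leibniz, ih]
    simp only [smul_eq_mul, map_sub, Derivation.leibniz, derivative_C, derivative_X,
      mul_one, derivative_one]
    linear_combination harmonicProd n * h3

/-- Both sides have constant term `1` and the same logarithmic derivative, so their quotient has
derivative zero. -/
theorem exp_subst_eq_harmonicProd (n : ℕ) :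
    (PowerSeries.exp ℝ).subst (PowerSeries.mk fun m => if m = 0 then 0 else
      -((m - 1).factorial * harmonicNumber m n) / m.factorial) = harmonicProd n := by
  set g : ℝ⟦X⟧ := PowerSeries.mk fun m => if m = 0 then 0 else
      -((m - 1).factorial * harmonicNumber m n) / m.factorial with hg
  have hg0 : constantCoeff g = 0 := by
    rw [← coeff_zero_eq_constantCoeff_apply, hg, coeff_mk, if_pos rfl]
  have hsub : HasSubst g := HasSubst.of_constantCoeff_zero' hg0
  have hdg : d⁄dX ℝ g = mk fun m => -harmonicNumber (m + 1) n := by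
    ext m
    rw [coeff_derivative, hg, coeff_mk, coeff_mk, if_neg (Nat.succ_ne_zero m), Nat.add_sub_cancel,
      Nat.factorial_succ]
    have : (m.factorial : ℝ) ≠ 0 := by positivity
    have : (m + 1 : ℝ) ≠ 0 := by positivity
    push_cast
    field_simp
  set E := (PowerSeries.exp ℝ).subst g with hE
  have hdE : d⁄dX ℝ E = E * d⁄dX ℝ g := by
    rw [hE, derivative_subst hsub, derivative_exp]
  have hE0 : constantCoeff E = 1 := by
    have h1 : PowerSeries.exp ℝ = 1 + (PowerSeries.exp ℝ - 1) := by ring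
    have h2 : constantCoeff ((PowerSeries.exp ℝ - 1).subst g : ℝ⟦X⟧) = 0 :=
      constantCoeff_subst_eq_zero hg0 _ (by simp)
    rw [hE, h1, subst_add hsub, map_add, h2, ← coe_substAlgHom hsub, map_one]
    simp
  have hQ0 := constantCoeff_harmonicProd n
  have hQinv : harmonicProd n * (harmonicProd n)⁻¹ = 1 :=
    PowerSeries.mul_inv_cancel _ (by simp [hQ0])
  have h : E * (harmonicProd n)⁻¹ = 1 := by
    refine derivative.ext ?_ (by simp [hE0, hQ0])
    rw [Derivation.leibniz, derivative_inv', hdE, hdg, derivative_harmonicProd, derivative_one]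
    simp only [smul_eq_mul]
    linear_combination (-E * (harmonicProd n)⁻¹ * mk fun m => -harmonicNumber (m + 1) n) * hQinv
  linear_combination harmonicProd n * h - E * hQinv

end PowerSeries

open PowerSeries

theorem expectedPaths_eq_coeff_of_eq_half (p : unitInterval) (hp : (p : ℝ) = 1 / 2) (m : ℕ) :
    expectedPaths p (m + 1) = coeff m (oneSubPow (-1) *
      (1 - (1 / 2 : ℝ) • antideriv (oneSubPow (-1)))⁻¹) := by
  rw [expectedPaths_eq_coeff, hp]
  norm_num

theorem expectedPaths_eq_sum_completeBell (p : unitInterval) (hp : (p : ℝ) = 1 / 2) (n : ℕ)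
    (hn : 1 ≤ n) :
    expectedPaths p n = ∑ k ∈ Finset.range n, (-1 : ℝ) ^ k / 2 ^ k *
      completeBell k fun m => -((m - 1).factorial * harmonicNumber m (n - 1)) := by
  obtain ⟨m, rfl⟩ := Nat.exists_eq_add_of_le' hn
  rw [expectedPaths_eq_coeff_of_eq_half p hp,
    coeff_mul_inv_one_sub _ (by simp [constantCoeff_antideriv])]
  refine Finset.sum_congr rfl fun k _ => ?_
  rw [Nat.add_sub_cancel, completeBell, exp_subst_eq_harmonicProd, ← coeff_mul_antideriv_neg_pow,
    neg_pow (antideriv _), smul_pow, mul_smul_comm, coeff_smul]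
  have h1 : ((-1 : ℝ⟦X⟧) ^ k) = C ((-1 : ℝ) ^ k) := by simp
  rw [h1, mul_left_comm, coeff_C_mul, smul_eq_mul, one_div, inv_pow, ← mul_assoc, div_mul_eq_mul_div,
    ← pow_add, Even.neg_one_pow ⟨k, rfl⟩, one_div]

/-! ### From analytic functions to formal power series -/

/-- The formal Taylor series at `0` of a complex function. -/
noncomputable def taylorSeries (F : ℂ → ℂ) : PowerSeries ℂ :=
  PowerSeries.mk fun n => iteratedDeriv n F 0 / n.factorial

namespace taylorSeries

open PowerSeries

theorem congr {F G : ℂ → ℂ} (h : F =ᶠ[𝓝 0] G) : taylorSeries F = taylorSeries G := by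
  ext n
  simp [taylorSeries, h.iteratedDeriv_eq n]

theorem mul {F G : ℂ → ℂ} (hF : AnalyticAt ℂ F 0) (hG : AnalyticAt ℂ G 0) :
    taylorSeries (fun z => F z * G z) = taylorSeries F * taylorSeries G := by
  ext n
  rw [coeff_mul, Finset.Nat.sum_antidiagonal_eq_sum_range_succ
    (fun i j => coeff i (taylorSeries F) * coeff j (taylorSeries G))]
  simp only [taylorSeries, coeff_mk]
  rw [iteratedDeriv_fun_mul hF.contDiffAt hG.contDiffAt, Finset.sum_div]
  refine Finset.sum_congr rfl fun i hi => ?_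
  rw [Nat.cast_choose ℂ (Nat.lt_succ_iff.1 (Finset.mem_range.1 hi))]
  have h1 : (n.factorial : ℂ) ≠ 0 := by exact_mod_cast n.factorial_ne_zero
  field_simp

theorem add {F G : ℂ → ℂ} (hF : AnalyticAt ℂ F 0) (hG : AnalyticAt ℂ G 0) :
    taylorSeries (fun z => F z + G z) = taylorSeries F + taylorSeries G := by
  ext n
  simp only [taylorSeries, coeff_mk, map_add]
  rw [iteratedDeriv_fun_add hF.contDiffAt hG.contDiffAt, add_div]

theorem const (c : ℂ) : taylorSeries (fun _ => c) = C c := by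
  ext n
  simp only [taylorSeries, coeff_mk, iteratedDeriv_const, coeff_C]
  split_ifs with h <;> simp [h]

theorem id : taylorSeries (fun z => z) = X := by
  ext n
  simp only [taylorSeries, coeff_mk, iteratedDeriv_fun_id_zero, coeff_X]
  split_ifs with h <;> simp [h]

theorem const_mul {F : ℂ → ℂ} (c : ℂ) (hF : AnalyticAt ℂ F 0) :
    taylorSeries (fun z => c * F z) = C c * taylorSeries F := by
  rw [mul analyticAt_const hF, const]

theorem const_sub_id (c : ℂ) : taylorSeries (fun z => c - z) = C c - X := by
  have h1 : taylorSeries (fun z => -1 * z) = C (-1) * X := by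
    rw [const_mul (-1) (F := fun z => z) analyticAt_id, id]
  have h2 := add (F := fun _ => c) (G := fun z => -1 * z) analyticAt_const (by fun_prop)
  rw [h1, const] at h2
  simp only [neg_mul, one_mul, ← sub_eq_add_neg] at h2
  rw [h2]
  simp [sub_eq_add_neg]

theorem derivative (F : ℂ → ℂ) : d⁄dX ℂ (taylorSeries F) = taylorSeries (deriv F) := by
  ext n
  rw [coeff_derivative]
  simp only [taylorSeries, coeff_mk, iteratedDeriv_succ', Nat.factorial_succ]
  have h1 : (n.factorial : ℂ) ≠ 0 := by exact_mod_cast n.factorial_ne_zero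
  have h2 : (n + 1 : ℂ) ≠ 0 := by exact_mod_cast n.succ_ne_zero
  push_cast
  field_simp

theorem constantCoeff (F : ℂ → ℂ) : PowerSeries.constantCoeff (taylorSeries F) = F 0 := by
  rw [← coeff_zero_eq_constantCoeff_apply]
  simp [taylorSeries]

theorem coeff_inv_sub {a : ℂ} (ha : a ≠ 0) (n : ℕ) :
    coeff n (taylorSeries fun z => (z - a)⁻¹) = -(a⁻¹) ^ (n + 1) := by
  have han : AnalyticAt ℂ (fun z : ℂ => (z - a)⁻¹) 0 :=
    (analyticAt_id.sub analyticAt_const).inv (by simpa using ha)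
  have h1 : (C a - X) * taylorSeries (fun z => (z - a)⁻¹) = C (-1) := by
    rw [← const_sub_id, ← const, ← mul (F := fun z => a - z) (by fun_prop) han]
    refine congr ?_
    filter_upwards [isOpen_ne.mem_nhds ha.symm] with z hz
    rw [← neg_sub z a, neg_mul, mul_inv_cancel₀ (sub_ne_zero.2 hz)]
  induction n with
  | zero =>
    have h2 := congrArg (coeff 0) h1
    rw [sub_mul, map_sub, coeff_C_mul, coeff_zero_X_mul, coeff_zero_C] at h2
    refine mul_left_cancel₀ ha ?_
    rw [zero_add, pow_one, mul_neg, mul_inv_cancel₀ ha]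
    linear_combination h2
  | succ n ih =>
    have h2 := congrArg (coeff (n + 1)) h1
    rw [sub_mul, map_sub, coeff_C_mul, coeff_succ_X_mul, ih, coeff_C, if_neg (by omega)] at h2
    refine mul_left_cancel₀ ha ?_
    rw [pow_succ, mul_neg, mul_left_comm, mul_inv_cancel₀ ha]
    linear_combination h2

end taylorSeries

/-! ### Transfer of a bound near the singularity to the Taylor coefficients -/

/-- The complex plane cut along the real half-line `[1, ∞)`. -/
def cutPlane : Set ℂ :=
  {z | 1 - z ∈ Complex.slitPlane}

theorem isOpen_cutPlane : IsOpen cutPlane :=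
  Complex.isOpen_slitPlane.preimage (continuous_const.sub continuous_id)

theorem mem_cutPlane_of_re_lt_one {z : ℂ} (hz : z.re < 1) : z ∈ cutPlane :=
  Or.inl (by simpa using hz)

theorem mem_cutPlane_of_norm_le_one {z : ℂ} (hz : ‖z‖ ≤ 1) (h1 : z ≠ 1) : z ∈ cutPlane := by
  have h := (Complex.re_le_norm z).trans hz
  rcases h.lt_or_eq with h | h
  · exact mem_cutPlane_of_re_lt_one h
  · refine absurd (Complex.ext h ?_) h1
    have h2 := Complex.sq_norm z
    rw [Complex.normSq_apply, h] at h2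
    have h3 : ‖z‖ ^ 2 ≤ 1 := by nlinarith [norm_nonneg z]
    simp only [Complex.one_im]
    nlinarith

/-- When `z.re < 1`, the point of the ray `[1, ∞)` nearest to `z` is its endpoint. -/
theorem closedBall_subset_cutPlane {z : ℂ} (hz : z.re < 1) {r : ℝ} (hr : r < ‖z - 1‖) :
    Metric.closedBall z r ⊆ cutPlane := by
  intro w hw
  rw [mem_closedBall_iff_norm] at hw
  by_contra hw'
  have h1 : 1 ≤ w.re ∧ w.im = 0 := by
    simpa [cutPlane, Complex.slitPlane, not_or] using hw'
  have h2 : ‖z - 1‖ ≤ ‖w - z‖ := by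
    rw [Complex.norm_def, Complex.norm_def]
    refine Real.sqrt_le_sqrt ?_
    simp only [Complex.normSq_apply, Complex.sub_re, Complex.sub_im, Complex.one_re,
      Complex.one_im, h1.2]
    nlinarith [h1.1]
  linarith

/-- Cauchy's estimate for the `M`-th derivative on circles of radius tending to `1` gives `n! * B`
for the derivative of order `n + M` at `0`; division by `(n + M)!` gains the power `n ^ (-M)`. -/
theorem isBigO_coeff_taylorSeries_of_bound {H : ℂ → ℂ} {M : ℕ} {B : ℝ}
    (hH : DifferentiableOn ℂ (iteratedDeriv M H) (Metric.ball 0 1))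
    (hB : ∀ z ∈ Metric.ball (0 : ℂ) 1, ‖iteratedDeriv M H z‖ ≤ B) :
    (fun n => PowerSeries.coeff n (taylorSeries H)) =O[atTop] fun n : ℕ => ((n : ℝ) ^ M)⁻¹ := by
  have hB0 : 0 ≤ B := (norm_nonneg _).trans (hB 0 (by simp))
  have h1 : ∀ n, ‖iteratedDeriv (n + M) H 0‖ ≤ n.factorial * B := by
    intro n
    have h2 : ∀ r ∈ Set.Ioo (0 : ℝ) 1,
        ‖iteratedDeriv (n + M) H 0‖ ≤ n.factorial * B / r ^ n := by
      intro r hr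
      have hsub : Metric.closedBall (0 : ℂ) r ⊆ Metric.ball 0 1 :=
        Metric.closedBall_subset_ball hr.2
      have h3 := Complex.norm_iteratedDeriv_le_of_forall_mem_sphere_norm_le (c := 0) n hr.1
        (hH.mono hsub |>.diffContOnCl_ball subset_rfl)
        (fun z hz => hB z (hsub (Metric.sphere_subset_closedBall hz)))
      rwa [iteratedDeriv_eq_iterate, iteratedDeriv_eq_iterate, ← Function.iterate_add_apply,
        ← iteratedDeriv_eq_iterate] at h3
    have h4 : Tendsto (fun r : ℝ => n.factorial * B / r ^ n) (𝓝[<] 1)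
        (𝓝 (n.factorial * B / 1 ^ n)) :=
      ((continuousAt_const.div (continuousAt_id.pow n) (by simp)).tendsto).mono_left
        nhdsWithin_le_nhds
    rw [one_pow, div_one] at h4
    refine ge_of_tendsto h4 ?_
    filter_upwards [Ioo_mem_nhdsLT zero_lt_one] with r hr using h2 r hr
  refine Asymptotics.IsBigO.of_bound (B * (M + 1) ^ M) ?_
  filter_upwards [eventually_ge_atTop M, eventually_gt_atTop 0] with N hN hN0
  obtain ⟨n, rfl⟩ := Nat.exists_eq_add_of_le' hN
  have h5 : ((n + M : ℕ) : ℝ) ^ M * n.factorial ≤ (M + 1) ^ M * (n + M).factorial := by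
    have h6 : (n + 1) ^ M * n.factorial ≤ (n + M).factorial := by
      rw [mul_comm, ← Nat.factorial_mul_ascFactorial]
      exact Nat.mul_le_mul_left _ (Nat.pow_succ_le_ascFactorial (n + 1) M)
    -- The constant comes from `n + M ≤ (M + 1) * (n + 1)`.
    have h7 : (n + M) ^ M ≤ (M + 1) ^ M * (n + 1) ^ M := by
      rw [← mul_pow]
      exact Nat.pow_le_pow_left (by nlinarith) M
    have h8 : (n + M) ^ M * n.factorial ≤ (M + 1) ^ M * (n + M).factorial := by
      calc (n + M) ^ M * n.factorial ≤ (M + 1) ^ M * (n + 1) ^ M * n.factorial :=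
            Nat.mul_le_mul_right _ h7
        _ ≤ _ := by rw [mul_assoc]; exact Nat.mul_le_mul_left _ h6
    exact_mod_cast h8
  have hpos : (0 : ℝ) < ((n + M : ℕ) : ℝ) ^ M := by positivity
  have hfac : (0 : ℝ) < ((n + M).factorial : ℝ) := by positivity
  rw [taylorSeries, PowerSeries.coeff_mk, norm_div, Complex.norm_natCast, norm_inv, norm_pow,
    Real.norm_natCast, div_le_iff₀ hfac]
  refine (h1 n).trans ?_
  rw [← div_eq_mul_inv, div_mul_eq_mul_div, le_div_iff₀ hpos]
  nlinarith

/-- `N / D` is its polar part `a / (z - x₀)`, with coefficients `-a * x₀⁻¹ ^ (n + 1)`, plus a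
function `H` analytic in the cut plane. The `M`-th derivative of `H` is bounded on the unit disc:
near `1` by Cauchy estimates on discs avoiding the cut, elsewhere by compactness. No contour outside
the disc is needed. -/
theorem isBigO_coeff_of_simple_pole {N D : ℂ → ℂ} {M : ℕ} {x₀ C a : ℝ} {F : PowerSeries ℝ}
    (hN : DifferentiableOn ℂ N cutPlane) (hD : DifferentiableOn ℂ D cutPlane)
    (hx0 : 0 < x₀) (hx1 : x₀ < 1) (hzero : ∀ z ∈ cutPlane, D z = 0 ↔ z = x₀)
    (ha : N x₀ = a * deriv D x₀) (hsimple : deriv D x₀ ≠ 0)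
    (hbound : ∀ᶠ z in 𝓝 (1 : ℂ), z ∈ cutPlane → ‖N z‖ ≤ C * ‖z - 1‖ ^ M * ‖D z‖)
    (hF : F.map Complex.ofRealHom * taylorSeries D = taylorSeries N) :
    (fun n => PowerSeries.coeff n F + a * (x₀⁻¹) ^ (n + 1)) =O[atTop]
      fun n : ℕ => ((n : ℝ) ^ M)⁻¹ := by
  have hopen := isOpen_cutPlane
  have hmem : (x₀ : ℂ) ∈ cutPlane := mem_cutPlane_of_re_lt_one (by simpa using hx1)
  have hmem0 : (0 : ℂ) ∈ cutPlane := mem_cutPlane_of_re_lt_one (by simp)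
  have hx0' : (x₀ : ℂ) ≠ 0 := by exact_mod_cast hx0.ne'
  -- Dividing out the simple zero: `D = (z - x₀) E` with `E` zero-free in the cut plane.
  set E := dslope D x₀ with hE
  have hEd : DifferentiableOn ℂ E cutPlane :=
    (Complex.differentiableOn_dslope (hopen.mem_nhds hmem)).2 hD
  have hEmul : ∀ z, z ∈ cutPlane → (z - x₀) * E z = D z := by
    intro z _
    have h := sub_smul_dslope D (x₀ : ℂ) z
    rw [(hzero _ hmem).2 rfl, sub_zero] at h
    exact h
  have hE0 : ∀ z ∈ cutPlane, E z ≠ 0 := by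
    intro z hz h0
    by_cases hzx : z = x₀
    · rw [hzx, hE, dslope_same] at h0
      exact hsimple h0
    · exact hzx ((hzero z hz).1 (by rw [← hEmul z hz, h0, mul_zero]))
  set Q := fun z => N z / E z with hQ
  have hQd : DifferentiableOn ℂ Q cutPlane := hN.div hEd hE0
  have hQx : Q x₀ = a := by
    rw [hQ]
    simp only
    rw [hE, dslope_same, ha, mul_div_cancel_right₀ _ hsimple]
  -- As `N / D = Q / (z - x₀)` and `Q x₀ = a`, the divided difference of `Q` is exactly `N / D`
  -- without its polar part.
  set H := dslope Q x₀ with hH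
  have hHd : DifferentiableOn ℂ H cutPlane :=
    (Complex.differentiableOn_dslope (hopen.mem_nhds hmem)).2 hQd
  have hHan : AnalyticOnNhd ℂ H cutPlane := hHd.analyticOnNhd hopen
  have hHMan : AnalyticOnNhd ℂ (iteratedDeriv M H) cutPlane := by
    rw [iteratedDeriv_eq_iterate]
    exact hHan.iterated_deriv M
  have hg : ∀ z ∈ cutPlane, z ≠ x₀ → N z / D z = H z + a * (z - x₀)⁻¹ := by
    intro z hz hzx
    have h := sub_smul_dslope Q (x₀ : ℂ) z
    have hzx' : z - x₀ ≠ 0 := sub_ne_zero.2 hzx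
    rw [hQx, smul_eq_mul, ← hH] at h
    have h2 : N z / D z = Q z / (z - x₀) := by
      rw [hQ, ← hEmul z hz]
      field_simp [hE0 z hz]
    rw [h2, eq_comm, eq_div_iff hzx']
    field_simp
    linear_combination h
  -- the coefficients in terms of those of `H`
  have hcoeff : ∀ n, ((PowerSeries.coeff n F + a * (x₀⁻¹) ^ (n + 1) : ℝ) : ℂ) =
      PowerSeries.coeff n (taylorSeries H) := by
    intro n
    have hne : ∀ᶠ z : ℂ in 𝓝 0, z ≠ x₀ := isOpen_ne.mem_nhds hx0'.symm
    have hDan : AnalyticAt ℂ D 0 := hD.analyticOnNhd hopen 0 hmem0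
    have hNan : AnalyticAt ℂ N 0 := hN.analyticOnNhd hopen 0 hmem0
    have hD0 : D 0 ≠ 0 := fun h => hx0' ((hzero 0 hmem0).1 h).symm
    have hDN : taylorSeries (fun z => N z / D z) * taylorSeries D = taylorSeries N := by
      rw [← taylorSeries.mul (hNan.fun_div hDan hD0) hDan]
      refine taylorSeries.congr ?_
      filter_upwards [hDan.continuousAt.eventually_ne hD0] with z hz
      exact div_mul_cancel₀ _ hz
    have hTD : taylorSeries D ≠ 0 := fun h => hD0 (by
      rw [← taylorSeries.constantCoeff D, h, map_zero])
    have hpole : AnalyticAt ℂ (fun z : ℂ => (z - x₀)⁻¹) 0 :=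
      (analyticAt_id.sub analyticAt_const).inv (by simpa using hx0')
    have hFg : F.map Complex.ofRealHom = taylorSeries H +
        PowerSeries.C (a : ℂ) * taylorSeries (fun z => (z - x₀)⁻¹) := by
      rw [mul_right_cancel₀ hTD (hF.trans hDN.symm), ← taylorSeries.const_mul _ hpole,
        ← taylorSeries.add (hHan 0 hmem0) (G := fun z => a * (z - x₀)⁻¹) (by fun_prop)]
      refine taylorSeries.congr ?_
      filter_upwards [hne, hopen.mem_nhds hmem0] with z hz hz'
      exact hg z hz' hz
    have h := congrArg (PowerSeries.coeff n) hFg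
    rw [PowerSeries.coeff_map, map_add, PowerSeries.coeff_C_mul, taylorSeries.coeff_inv_sub hx0'] at h
    simp only [Complex.ofRealHom_eq_coe] at h
    push_cast
    rw [h]
    ring
  -- the derivative of `H` is bounded near the singularity
  have hnear : ∃ B, ∀ᶠ z in 𝓝 (1 : ℂ), ‖z‖ < 1 → ‖iteratedDeriv M H z‖ ≤ B := by
    set P : ℂ → ℂ := fun z => a * (z - x₀)⁻¹ with hP
    have hPan : AnalyticOnNhd ℂ P {z | z ≠ x₀} := fun z hz =>
      analyticAt_const.mul ((analyticAt_id.sub analyticAt_const).inv (sub_ne_zero.2 hz))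
    have hPM : ContinuousAt (iteratedDeriv M P) 1 := by
      rw [iteratedDeriv_eq_iterate]
      refine (hPan.iterated_deriv M 1 ?_).continuousAt
      simpa using fun h : (1 : ℂ) = x₀ => hx1.ne' (by exact_mod_cast h)
    have hPb := hPM.norm.eventually (gt_mem_nhds (lt_add_one _))
    obtain ⟨ε, hε, hεb⟩ := Metric.eventually_nhds_iff.1 hbound
    have hx1' : (1 : ℂ) ≠ x₀ := fun h => hx1.ne' (by exact_mod_cast h)
    -- On the disc of radius `r / 2` about `z`, with `r = ‖z - 1‖`, the quotient is at most `C * (3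
    -- / 2 * r) ^ M`; Cauchy's estimate divides by `(r / 2) ^ M`, leaving `3 ^ M`. The other summand
    -- bounds the polar part.
    refine ⟨M.factorial * (C * 3 ^ M) + (‖iteratedDeriv M P 1‖ + 1), ?_⟩
    -- The first bound keeps the disc where `hbound` holds, the second keeps the pole outside it.
    have hr : ∀ᶠ z in 𝓝 (1 : ℂ), ‖z - 1‖ < min (ε / 2) (‖(1 : ℂ) - x₀‖ / 2) := by
      have : 0 < min (ε / 2) (‖(1 : ℂ) - x₀‖ / 2) :=
        lt_min (half_pos hε) (half_pos (norm_pos_iff.2 (sub_ne_zero.2 hx1')))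
      filter_upwards [Metric.ball_mem_nhds (1 : ℂ) this] with z hz
      exact mem_ball_iff_norm.1 hz
    filter_upwards [hPb, hr] with z hz1 hz2 hz
    have hre : z.re < 1 := (Complex.re_le_norm z).trans_lt hz
    have hz1' : z ≠ 1 := fun h => by simp [h] at hz
    set r := ‖z - 1‖ with hrdef
    have hr0 : 0 < r := norm_pos_iff.2 (sub_ne_zero.2 hz1')
    have hball : Metric.closedBall z (r / 2) ⊆ cutPlane :=
      closedBall_subset_cutPlane hre (half_lt_self hr0)
    have hdist : ∀ w ∈ Metric.closedBall z (r / 2), ‖w - 1‖ ≤ 3 / 2 * r := by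
      intro w hw
      rw [mem_closedBall_iff_norm] at hw
      calc ‖w - 1‖ = ‖(w - z) + (z - 1)‖ := by ring_nf
        _ ≤ ‖w - z‖ + ‖z - 1‖ := norm_add_le _ _
        _ ≤ 3 / 2 * r := by linarith
    have hnex : ∀ w ∈ Metric.closedBall z (r / 2), w ≠ x₀ := by
      rintro w hw rfl
      have h1 := hdist _ hw
      rw [norm_sub_rev] at h1
      have h2 := hz2.trans_le (min_le_right _ _)
      linarith
    have hgd : DifferentiableOn ℂ (fun w => N w / D w) (Metric.closedBall z (r / 2)) :=
      (hN.mono hball).div (hD.mono hball) fun w hw h0 =>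
        hnex w hw ((hzero w (hball hw)).1 h0)
    have hgM := Complex.norm_iteratedDeriv_le_of_forall_mem_sphere_norm_le (C := C * (3 / 2 * r) ^ M)
      M (half_pos hr0) (hgd.diffContOnCl_ball subset_rfl) (by
        intro w hw
        have hw' := Metric.sphere_subset_closedBall hw
        have hd := hdist w hw'
        have h1 : ‖N w‖ ≤ C * ‖w - 1‖ ^ M * ‖D w‖ := by
          refine hεb ?_ (hball hw')
          rw [dist_eq_norm]
          have h2 := hz2.trans_le (min_le_left _ _)
          linarith
        have hDw : 0 < ‖D w‖ := norm_pos_iff.2 fun h0 => hnex w hw' ((hzero w (hball hw')).1 h0)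
        have hw1 : w ≠ 1 := by
          rintro rfl
          have := hball hw'
          simp [cutPlane] at this
        have hw1' : 0 < ‖w - 1‖ ^ M := pow_pos (norm_pos_iff.2 (sub_ne_zero.2 hw1)) M
        have hC : 0 ≤ C := by
          by_contra hC
          have : C * ‖w - 1‖ ^ M * ‖D w‖ < 0 :=
            mul_neg_of_neg_of_pos (mul_neg_of_neg_of_pos (not_le.1 hC) hw1') hDw
          linarith [norm_nonneg (N w)]
        rw [norm_div, div_le_iff₀ hDw]
        refine h1.trans ?_
        gcongr)
    have hgM' : ‖iteratedDeriv M (fun w => N w / D w) z‖ ≤ M.factorial * (C * 3 ^ M) := by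
      refine hgM.trans (le_of_eq ?_)
      rw [show 3 / 2 * r = 3 * (r / 2) by ring, mul_pow, ← mul_assoc, ← mul_assoc,
        mul_div_cancel_right₀ _ (pow_pos (half_pos hr0) M).ne', mul_assoc]
    have hzball : z ∈ Metric.closedBall z (r / 2) := Metric.mem_closedBall_self (half_pos hr0).le
    have hHeq : iteratedDeriv M H z =
        iteratedDeriv M (fun w => N w / D w) z - iteratedDeriv M P z := by
      have hcont : ContDiffAt ℂ M (fun w => N w / D w) z :=
        ((hgd.mono Metric.ball_subset_closedBall).analyticOnNhd Metric.isOpen_ball z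
          (Metric.mem_ball_self (half_pos hr0))).contDiffAt
      rw [← iteratedDeriv_fun_sub hcont (hPan z (hnex z hzball)).contDiffAt]
      refine Filter.EventuallyEq.iteratedDeriv_eq M ?_
      filter_upwards [Metric.closedBall_mem_nhds z (half_pos hr0)] with w hw
      rw [hg w (hball hw) (hnex w hw)]
      simp [hP]
    rw [hHeq]
    exact (norm_sub_le _ _).trans (add_le_add hgM' hz1.le)
  obtain ⟨B₁, hB₁⟩ := hnear
  obtain ⟨ε, hε, hB₁⟩ := Metric.eventually_nhds_iff.1 hB₁
  have hcomp : IsCompact (Metric.closedBall (0 : ℂ) 1 \ Metric.ball 1 ε) :=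
    (isCompact_closedBall _ _).diff Metric.isOpen_ball
  obtain ⟨B₂, hB₂⟩ := hcomp.exists_bound_of_continuousOn (f := iteratedDeriv M H) (by
    refine hHMan.continuousOn.mono ?_
    rintro z ⟨hz1, hz2⟩
    refine mem_cutPlane_of_norm_le_one (by simpa using hz1) ?_
    rintro rfl
    exact hz2 (Metric.mem_ball_self hε))
  have hsub : Metric.ball (0 : ℂ) 1 ⊆ cutPlane := fun z hz =>
    mem_cutPlane_of_re_lt_one ((Complex.re_le_norm z).trans_lt (by simpa using hz))
  have hfinal := isBigO_coeff_taylorSeries_of_bound (B := max B₁ B₂)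
    (hHMan.differentiableOn.mono hsub) (by
      intro z hz
      by_cases hz1 : z ∈ Metric.ball (1 : ℂ) ε
      · exact (hB₁ hz1 (by simpa using hz)).trans (le_max_left _ _)
      · exact (hB₂ z ⟨Metric.ball_subset_closedBall hz, hz1⟩).trans (le_max_right _ _))
  refine Asymptotics.IsBigO.of_norm_left ?_
  refine hfinal.norm_left.congr_left fun n => ?_
  rw [← hcoeff, Complex.norm_real]

/-! ### Powers and logarithm of `1 - z`, and the poles of the generating functions -/

theorem hasDerivAt_one_sub_cpow (b : ℂ) {z : ℂ} (hz : z ∈ cutPlane) :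
    HasDerivAt (fun z : ℂ => (1 - z) ^ b) (-(b * (1 - z) ^ (b - 1))) z := by
  have h1 : HasDerivAt (fun z : ℂ => 1 - z) (-1) z := by
    simpa using (hasDerivAt_id z).const_sub 1
  simpa using h1.cpow_const (c := b) hz

theorem hasDerivAt_log_one_sub {z : ℂ} (hz : z ∈ cutPlane) :
    HasDerivAt (fun z : ℂ => Complex.log (1 - z)) (-(1 - z)⁻¹) z := by
  have h1 : HasDerivAt (fun z : ℂ => 1 - z) (-1) z := by
    simpa using (hasDerivAt_id z).const_sub 1
  have h2 := h1.clog hz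
  rwa [neg_div, one_div] at h2

theorem zero_mem_cutPlane : (0 : ℂ) ∈ cutPlane :=
  mem_cutPlane_of_re_lt_one (by simp)

theorem ne_one_of_mem_cutPlane {z : ℂ} (hz : z ∈ cutPlane) : 1 - z ≠ 0 :=
  Complex.slitPlane_ne_zero hz

theorem differentiableOn_one_sub_cpow (b : ℂ) :
    DifferentiableOn ℂ (fun z : ℂ => (1 - z) ^ b) cutPlane :=
  fun _ hz => (hasDerivAt_one_sub_cpow b hz).differentiableAt.differentiableWithinAt

theorem differentiableOn_log_one_sub :
    DifferentiableOn ℂ (fun z : ℂ => Complex.log (1 - z)) cutPlane :=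
  fun _ hz => (hasDerivAt_log_one_sub hz).differentiableAt.differentiableWithinAt

theorem analyticAt_zero_of_differentiableOn_cutPlane {F : ℂ → ℂ}
    (h : DifferentiableOn ℂ F cutPlane) : AnalyticAt ℂ F 0 :=
  h.analyticOnNhd isOpen_cutPlane 0 zero_mem_cutPlane

theorem taylorSeries_one_sub_cpow (b : ℝ) :
    taylorSeries (fun z => (1 - z) ^ (b : ℂ)) = (oneSubPow b).map Complex.ofRealHom := by
  set F : ℂ → ℂ := fun z => (1 - z) ^ (b : ℂ) with hF
  have hFan : AnalyticAt ℂ F 0 :=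
    analyticAt_zero_of_differentiableOn_cutPlane (differentiableOn_one_sub_cpow b)
  have hode : (1 - X) * d⁄dX ℂ (taylorSeries F) = C (-b : ℂ) * taylorSeries F := by
    have h1 := taylorSeries.const_sub_id 1
    rw [map_one] at h1
    rw [taylorSeries.derivative, ← taylorSeries.const_mul _ hFan, ← h1,
      ← taylorSeries.mul (F := fun z => 1 - z) (by fun_prop) hFan.deriv]
    refine taylorSeries.congr ?_
    filter_upwards [isOpen_cutPlane.mem_nhds zero_mem_cutPlane] with z hz
    have hz0 := ne_one_of_mem_cutPlane hz
    rw [(hasDerivAt_one_sub_cpow b hz).deriv, Complex.cpow_sub _ _ hz0, Complex.cpow_one, hF]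
    field_simp
  ext n
  induction n with
  | zero =>
    rw [coeff_zero_eq_constantCoeff_apply, taylorSeries.constantCoeff]
    simp [hF, constantCoeff_oneSubPow]
  | succ n ih =>
    have h1 := congrArg (coeff n) hode
    have h2 := congrArg (fun x : ℝ => (x : ℂ)) (coeff_succ_oneSubPow b n)
    simp only [Complex.ofReal_mul, Complex.ofReal_add, Complex.ofReal_sub, Complex.ofReal_natCast,
      Complex.ofReal_one] at h2
    rw [coeff_one_sub_X_mul_derivative, coeff_C_mul, ih] at h1
    rw [coeff_map] at h1 ⊢
    simp only [Complex.ofRealHom_eq_coe] at h1 ⊢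
    have hn : (n + 1 : ℂ) ≠ 0 := by exact_mod_cast n.succ_ne_zero
    refine mul_left_cancel₀ hn ?_
    linear_combination h1 - h2

theorem taylorSeries_log_one_sub :
    taylorSeries (fun z => Complex.log (1 - z)) =
      -(antideriv (oneSubPow (-1))).map Complex.ofRealHom := by
  refine derivative.ext ?_ ?_
  · have h1 : d⁄dX ℂ ((antideriv (oneSubPow (-1))).map Complex.ofRealHom) =
        (oneSubPow (-1)).map Complex.ofRealHom := by
      nth_rw 2 [← derivative_antideriv (oneSubPow (-1))]
      ext n
      simp [coeff_derivative]
    rw [map_neg, h1, ← taylorSeries_one_sub_cpow, taylorSeries.derivative, ← neg_one_mul,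
      show (-1 : PowerSeries ℂ) = C (-1) by simp, ← taylorSeries.const_mul _
        (analyticAt_zero_of_differentiableOn_cutPlane (differentiableOn_one_sub_cpow _))]
    refine taylorSeries.congr ?_
    filter_upwards [isOpen_cutPlane.mem_nhds zero_mem_cutPlane] with z hz
    rw [(hasDerivAt_log_one_sub hz).deriv]
    simp [Complex.cpow_neg_one]
  · rw [taylorSeries.constantCoeff, map_neg, ← coeff_zero_eq_constantCoeff_apply, coeff_map,
      coeff_zero_eq_constantCoeff_apply, constantCoeff_antideriv]
    simp

/-- The location of the zero of `1 - c * (1 - z) ^ δ`. -/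
theorem one_sub_rpow_mem_Ioo {c δ : ℝ} (hc : 1 < c) (hδ : 0 < δ) :
    1 - c ^ (-1 / δ) ∈ Set.Ioo (0 : ℝ) 1 := by
  have h1 : 0 < c ^ (-1 / δ) := Real.rpow_pos_of_pos (by linarith) _
  have h2 : c ^ (-1 / δ) < 1 :=
    Real.rpow_lt_one_of_one_lt_of_neg hc (div_neg_of_neg_of_pos (by norm_num) hδ)
  constructor <;> linarith

/-- Since `δ < 1`, the imaginary part of `δ * log w` stays strictly between `-π` and `π`, so taking
logarithms gives a unique solution. -/
theorem mul_cpow_eq_one_iff {c δ : ℝ} (hc : 1 < c) (hδ : 0 < δ) (hδ1 : δ < 1) {w : ℂ}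
    (hw : w ∈ Complex.slitPlane) : (c : ℂ) * w ^ (δ : ℂ) = 1 ↔ w = (c ^ (-1 / δ) : ℝ) := by
  have hc0 : 0 < c := by linarith
  have hw0 := Complex.slitPlane_ne_zero hw
  have hcexp : c ^ (-1 / δ) = Real.exp (-(Real.log c / δ)) := by
    rw [Real.rpow_def_of_pos hc0]
    congr 1
    ring
  have hδ' : (δ : ℂ) ≠ 0 := by exact_mod_cast hδ.ne'
  constructor
  · intro h
    have h1 : Complex.exp (Complex.log w * δ) = Complex.exp (-Real.log c : ℝ) := by
      rw [← Complex.cpow_def_of_ne_zero hw0, ← Complex.ofReal_exp, Real.exp_neg, Real.exp_log hc0]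
      push_cast
      exact eq_inv_of_mul_eq_one_right h
    have h2 : Complex.log w * δ = (-Real.log c : ℝ) := by
      have him : (Complex.log w * δ).im = (Complex.log w).im * δ := by simp
      have hpi := Real.pi_pos
      have h3 := Complex.neg_pi_lt_log_im w
      have h4 := Complex.log_im_le_pi w
      rw [← Complex.log_exp (x := Complex.log w * δ), h1, Complex.log_exp]
      · simpa using hpi
      · simpa using hpi.le
      · rw [him]; nlinarith
      · rw [him]; nlinarith
    rw [hcexp, ← Complex.exp_log hw0, Complex.ofReal_exp]
    congr 1
    push_cast at h2 ⊢
    field_simp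
    linear_combination h2
  · rintro rfl
    rw [← Complex.ofReal_cpow (Real.rpow_nonneg hc0.le _), ← Real.rpow_mul hc0.le,
      div_mul_cancel₀ _ hδ.ne', Real.rpow_neg_one]
    exact_mod_cast mul_inv_cancel₀ hc0.ne'

/-- With `y = c ^ (-1 / δ)`, the pole is at `1 - y`, where the denominator has derivative `δ / y`
and the numerator is `y ^ B`. Near `1` the denominator tends to `1` and the numerator is `O(|z - 1|
^ 2)`. -/
theorem isBigO_coeff_oneSubPow_mul_inv {c δ B : ℝ} (hc : 1 < c) (hδ : 0 < δ) (hδ1 : δ < 1)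
    (hB : 2 ≤ B) :
    (fun n => coeff n (oneSubPow B * (1 - c • oneSubPow δ)⁻¹) +
      (c ^ (-1 / δ)) ^ (B + 1) / δ * ((1 - c ^ (-1 / δ))⁻¹) ^ (n + 1)) =O[atTop]
        fun n : ℕ => ((n : ℝ) ^ 2)⁻¹ := by
  have hc0 : 0 < c := by linarith
  obtain ⟨hx0, hx1⟩ := one_sub_rpow_mem_Ioo hc hδ
  set y : ℝ := c ^ (-1 / δ) with hy
  have hy0 : 0 < y := Real.rpow_pos_of_pos hc0 _
  have hyδ : c * y ^ δ = 1 := by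
    rw [hy, ← Real.rpow_mul hc0.le, div_mul_cancel₀ _ hδ.ne', Real.rpow_neg_one,
      mul_inv_cancel₀ hc0.ne']
  have hmem : ((1 - y : ℝ) : ℂ) ∈ cutPlane := mem_cutPlane_of_re_lt_one (by simpa using hy0)
  have hNd := differentiableOn_one_sub_cpow (B : ℂ)
  have hPd := differentiableOn_one_sub_cpow (δ : ℂ)
  have hDd : DifferentiableOn ℂ (fun z : ℂ => 1 + (-c : ℂ) * (1 - z) ^ (δ : ℂ)) cutPlane :=
    (differentiableOn_const _).add ((differentiableOn_const _).mul hPd)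
  have hsub : (1 - ((1 - y : ℝ) : ℂ)) = (y : ℂ) := by push_cast; ring
  have hderiv : deriv (fun z : ℂ => 1 + (-c : ℂ) * (1 - z) ^ (δ : ℂ)) ((1 - y : ℝ) : ℂ) =
      ((δ / y : ℝ) : ℂ) := by
    have h1 := ((hasDerivAt_one_sub_cpow (δ : ℂ) hmem).const_mul (-c : ℂ)).const_add 1
    rw [h1.deriv, hsub, ← Complex.ofReal_one, ← Complex.ofReal_sub, ← Complex.ofReal_cpow hy0.le,
      Real.rpow_sub_one hy0.ne']
    norm_cast
    field_simp
    linear_combination hyδ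
  have hnorm : Tendsto (fun z : ℂ => ‖z - 1‖) (𝓝 1) (𝓝 0) := by
    have : Continuous fun z : ℂ => ‖z - 1‖ := by fun_prop
    simpa using this.tendsto 1
  refine isBigO_coeff_of_simple_pole (N := fun z => (1 - z) ^ (B : ℂ))
    (D := fun z => 1 + (-c : ℂ) * (1 - z) ^ (δ : ℂ)) (x₀ := 1 - y) (C := 2) hNd hDd hx0 hx1
    ?_ ?_ ?_ ?_ ?_
  · intro z hz
    have h1 := mul_cpow_eq_one_iff hc hδ hδ1 hz
    rw [← hy] at h1
    rw [show (1 + (-c : ℂ) * (1 - z) ^ (δ : ℂ) = 0) ↔ ((c : ℂ) * (1 - z) ^ (δ : ℂ) = 1) from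
      ⟨fun h => by linear_combination -h, fun h => by linear_combination -h⟩, h1]
    push_cast
    exact ⟨fun h => by linear_combination -h, fun h => by linear_combination -h⟩
  · rw [hderiv, hsub, ← Complex.ofReal_cpow hy0.le, ← Complex.ofReal_mul, Real.rpow_add_one hy0.ne']
    congr 1
    field_simp
  · rw [hderiv]
    exact_mod_cast (div_pos hδ hy0).ne'
  · have h1 : ∀ᶠ z : ℂ in 𝓝 1, c * ‖z - 1‖ ^ δ < 1 / 2 := by
      have h2 : Tendsto (fun z : ℂ => c * ‖z - 1‖ ^ δ) (𝓝 1) (𝓝 (c * 0 ^ δ)) :=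
        (hnorm.rpow_const (Or.inr hδ.le)).const_mul c
      rw [Real.zero_rpow hδ.ne', mul_zero] at h2
      exact h2.eventually (gt_mem_nhds (by norm_num))
    filter_upwards [h1, hnorm.eventually (gt_mem_nhds zero_lt_one)] with z hz1 hz2 hz
    have hz0 := ne_one_of_mem_cutPlane hz
    have hpos : 0 < ‖z - 1‖ := by rw [norm_sub_rev]; exact norm_pos_iff.2 hz0
    have h3 : ‖(1 - z) ^ (B : ℂ)‖ ≤ ‖z - 1‖ ^ 2 := by
      rw [Complex.norm_cpow_real, norm_sub_rev, ← Real.rpow_natCast]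
      exact Real.rpow_le_rpow_of_exponent_ge hpos hz2.le (by exact_mod_cast hB)
    have h4 : 1 / 2 ≤ ‖1 + (-c : ℂ) * (1 - z) ^ (δ : ℂ)‖ := by
      have h5 : ‖(-c : ℂ) * (1 - z) ^ (δ : ℂ)‖ = c * ‖z - 1‖ ^ δ := by
        rw [norm_mul, Complex.norm_cpow_real, norm_neg, Complex.norm_real, Real.norm_of_nonneg hc0.le,
          norm_sub_rev]
      have h6 := norm_sub_le_norm_add (1 : ℂ) ((-c : ℂ) * (1 - z) ^ (δ : ℂ))
      rw [h5, norm_one] at h6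
      linarith
    nlinarith [sq_nonneg ‖z - 1‖]
  · have hPan := analyticAt_zero_of_differentiableOn_cutPlane hPd
    rw [taylorSeries.add (G := fun z => (-c : ℂ) * (1 - z) ^ (δ : ℂ)) analyticAt_const
      (analyticAt_const.mul hPan), taylorSeries.const,
      taylorSeries.const_mul _ hPan, taylorSeries_one_sub_cpow, taylorSeries_one_sub_cpow]
    have hinv : (1 - c • oneSubPow δ)⁻¹ * (1 - c • oneSubPow δ) = 1 :=
      PowerSeries.inv_mul_cancel _ (by
        simpa [constantCoeff_oneSubPow, sub_eq_zero] using hc.ne)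
    have hcast : C (1 : ℂ) + C (-c : ℂ) * (oneSubPow δ).map Complex.ofRealHom =
        (1 - c • oneSubPow δ).map Complex.ofRealHom := by
      simp [smul_eq_C_mul, sub_eq_add_neg]
    rw [hcast, ← map_mul, mul_assoc, hinv, mul_one]

/-- The denominator is `1 + log (1 - z) / 2`, which vanishes only at `1 - z = exp (-2)`; the
numerator there is `exp (-2)` and the derivative `-exp 2 / 2`, which gives the residue `-2 * exp
(-4)`. -/
theorem isBigO_coeff_one_sub_mul_inv_log :
    (fun n => coeff n (oneSubPow 1 * (1 - (1 / 2 : ℝ) • antideriv (oneSubPow (-1)))⁻¹) +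
      -2 * Real.exp (-4) * ((1 - Real.exp (-2))⁻¹) ^ (n + 1)) =O[atTop]
        fun n : ℕ => ((n : ℝ) ^ 1)⁻¹ := by
  set y : ℝ := Real.exp (-2) with hy
  have hy0 : 0 < y := Real.exp_pos _
  have hy1 : y < 1 := Real.exp_lt_one_iff.2 (by norm_num)
  have hmem : ((1 - y : ℝ) : ℂ) ∈ cutPlane := mem_cutPlane_of_re_lt_one (by simpa using hy0)
  have hNd := differentiableOn_one_sub_cpow ((1 : ℝ) : ℂ)
  have hLd := differentiableOn_log_one_sub
  have hDd : DifferentiableOn ℂ (fun z : ℂ => 1 + (1 / 2 : ℂ) * Complex.log (1 - z)) cutPlane :=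
    (differentiableOn_const _).add ((differentiableOn_const _).mul hLd)
  have hsub : (1 - ((1 - y : ℝ) : ℂ)) = (y : ℂ) := by push_cast; ring
  have hderiv : deriv (fun z : ℂ => 1 + (1 / 2 : ℂ) * Complex.log (1 - z)) ((1 - y : ℝ) : ℂ) =
      ((-(1 / 2) * y⁻¹ : ℝ) : ℂ) := by
    have h1 := ((hasDerivAt_log_one_sub hmem).const_mul (1 / 2 : ℂ)).const_add 1
    rw [h1.deriv, hsub]
    push_cast
    ring
  have hnorm : Tendsto (fun z : ℂ => ‖z - 1‖) (𝓝 1) (𝓝 0) := by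
    have : Continuous fun z : ℂ => ‖z - 1‖ := by fun_prop
    simpa using this.tendsto 1
  refine isBigO_coeff_of_simple_pole (N := fun z => (1 - z) ^ ((1 : ℝ) : ℂ))
    (D := fun z => 1 + (1 / 2 : ℂ) * Complex.log (1 - z)) (x₀ := 1 - y) (C := 1) hNd hDd
    (by linarith) (by linarith) ?_ ?_ ?_ ?_ ?_
  · intro z hz
    have hz0 := ne_one_of_mem_cutPlane hz
    constructor
    · intro h
      have h1 : Complex.log (1 - z) = ((-2 : ℝ) : ℂ) := by push_cast; linear_combination 2 * h
      have h2 : 1 - z = (y : ℂ) := by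
        rw [← Complex.exp_log hz0, h1, hy, Complex.ofReal_exp]
      push_cast
      linear_combination -h2
    · rintro rfl
      rw [hsub, ← Complex.ofReal_log hy0.le, hy, Real.log_exp]
      push_cast
      norm_num
  · rw [hderiv, hsub, ← Complex.ofReal_cpow hy0.le, ← Complex.ofReal_mul, Real.rpow_one]
    congr 1
    rw [show (-4 : ℝ) = -2 + -2 by norm_num, Real.exp_add, ← hy]
    field_simp
  · rw [hderiv]
    have : -(1 / 2) * y⁻¹ ≠ 0 := mul_ne_zero (by norm_num) (inv_pos.2 hy0).ne'
    exact_mod_cast this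
  -- If `|1 - z| < exp (-4)`, the real part of the denominator is below `1 - 4 / 2 = -1`.
  · filter_upwards [hnorm.eventually (gt_mem_nhds (Real.exp_pos (-4)))] with z hz1 hz
    have hz0 := ne_one_of_mem_cutPlane hz
    have hpos : 0 < ‖1 - z‖ := norm_pos_iff.2 hz0
    rw [norm_sub_rev] at hz1
    have h1 : Real.log ‖1 - z‖ < -4 := by rwa [Real.log_lt_iff_lt_exp hpos]
    have h2 : 1 ≤ ‖1 + (1 / 2 : ℂ) * Complex.log (1 - z)‖ := by
      have h3 := Complex.abs_re_le_norm (1 + (1 / 2 : ℂ) * Complex.log (1 - z))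
      have h4 : (1 + (1 / 2 : ℂ) * Complex.log (1 - z)).re = 1 + 1 / 2 * Real.log ‖1 - z‖ := by
        rw [show (1 / 2 : ℂ) = ((1 / 2 : ℝ) : ℂ) by norm_num, Complex.add_re, Complex.re_ofReal_mul,
          Complex.log_re, Complex.one_re]
      rw [h4] at h3
      have h5 := neg_abs_le (1 + 1 / 2 * Real.log ‖1 - z‖)
      linarith
    rw [Complex.ofReal_one, Complex.cpow_one, one_mul, pow_one, norm_sub_rev z]
    nlinarith
  · have hLan := analyticAt_zero_of_differentiableOn_cutPlane hLd
    rw [taylorSeries.add (G := fun z => (1 / 2 : ℂ) * Complex.log (1 - z)) analyticAt_const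
      (analyticAt_const.mul hLan), taylorSeries.const,
      taylorSeries.const_mul _ hLan, taylorSeries_one_sub_cpow, taylorSeries_log_one_sub]
    have hinv : (1 - (1 / 2 : ℝ) • antideriv (oneSubPow (-1)))⁻¹ *
        (1 - (1 / 2 : ℝ) • antideriv (oneSubPow (-1))) = 1 :=
      PowerSeries.inv_mul_cancel _ (by simp [constantCoeff_antideriv])
    have hcast : C (1 : ℂ) + C (1 / 2 : ℂ) *
        -(antideriv (oneSubPow (-1))).map Complex.ofRealHom =
        (1 - (1 / 2 : ℝ) • antideriv (oneSubPow (-1))).map Complex.ofRealHom := by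
      simp [smul_eq_C_mul, sub_eq_add_neg]
    rw [hcast, ← map_mul, mul_assoc, hinv, mul_one]

/-! ### Bounds for binomial coefficients -/

theorem coeff_succ_oneSubPow_sub_one (x : ℝ) (n : ℕ) :
    coeff (n + 1) (oneSubPow (x - 1)) = coeff n (oneSubPow (x - 1)) * (1 - x / (n + 1)) := by
  rw [coeff_oneSubPow_eq_prod, coeff_oneSubPow_eq_prod, Finset.prod_range_succ, sub_add_cancel]

/-- Each factor `1 - x / (j + 1)` is at most `exp (-x (log (j + 2) - log (j + 1)))`, and the
logarithms telescope. The constants are kept explicit in `x` because the bound is later integrated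
over `x`. -/
theorem abs_coeff_oneSubPow_sub_one_le {x : ℝ} (hx : 0 ≤ x) {N n : ℕ} (hN : x ≤ N + 1)
    (hn : N ≤ n) :
    |coeff n (oneSubPow (x - 1))| ≤ |coeff N (oneSubPow (x - 1))| *
      Real.exp (x * Real.log (N + 1)) * Real.exp (-(x * Real.log (n + 1))) := by
  induction n, hn using Nat.le_induction with
  | base => rw [mul_assoc, ← Real.exp_add]; simp
  | succ n hn ih =>
    have hn' : (N : ℝ) ≤ n := by exact_mod_cast hn
    have hpos : (0 : ℝ) < n + 1 := by positivity
    have h1 : |1 - x / (n + 1)| ≤ Real.exp (-(x * (Real.log (n + 2) - Real.log (n + 1)))) := by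
      have h2 : x / (n + 1) ≤ 1 := by
        rw [div_le_one hpos]
        linarith
      rw [abs_of_nonneg (by linarith)]
      have h3 : Real.log (n + 2) - Real.log (n + 1) ≤ 1 / (n + 1) := by
        rw [← Real.log_div (by positivity) hpos.ne']
        refine (Real.log_le_sub_one_of_pos (by positivity)).trans (le_of_eq ?_)
        field_simp
        ring
      have h4 := Real.add_one_le_exp (-(x / (n + 1)))
      refine (by linarith : 1 - x / (n + 1) ≤ Real.exp (-(x / (n + 1)))).trans
        (Real.exp_le_exp.2 ?_)
      have := mul_le_mul_of_nonneg_left h3 hx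
      rw [mul_one_div] at this
      linarith
    rw [coeff_succ_oneSubPow_sub_one, abs_mul]
    refine (mul_le_mul ih h1 (abs_nonneg _) (by positivity)).trans (le_of_eq ?_)
    rw [mul_assoc, ← Real.exp_add]
    congr 2
    push_cast
    rw [add_assoc (n : ℝ) 1 1, one_add_one_eq_two]
    ring

theorem isBigO_coeff_oneSubPow_sub_one {x : ℝ} (hx : 0 ≤ x) :
    (fun n => coeff n (oneSubPow (x - 1))) =O[atTop] fun n : ℕ => (n + 1 : ℝ) ^ (-x) := by
  refine Asymptotics.IsBigO.of_bound (|coeff ⌈x⌉₊ (oneSubPow (x - 1))| *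
      Real.exp (x * Real.log (⌈x⌉₊ + 1))) ?_
  filter_upwards [eventually_ge_atTop ⌈x⌉₊] with n hn
  have hpos : (0 : ℝ) < n + 1 := by positivity
  have h := abs_coeff_oneSubPow_sub_one_le hx ((Nat.le_ceil x).trans (by linarith)) hn
  rw [Real.norm_eq_abs, Real.norm_of_nonneg (Real.rpow_nonneg hpos.le _),
    Real.rpow_def_of_pos hpos, mul_neg, mul_comm (Real.log (n + 1)) x]
  exact h

/-- The first factor of the product is `1 - x`; the others are bounded below by Bernoulli's
inequality `(1 - 1 / (n + 2)) ^ x ≤ 1 - x / (n + 2)`, and the left sides telescope. -/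
theorem coeff_oneSubPow_sub_one_ge {x : ℝ} (hx : 0 ≤ x) (hx1 : x ≤ 1) (n : ℕ) :
    (1 - x) * Real.exp (-(x * Real.log (n + 1))) ≤ coeff n (oneSubPow (x - 1)) := by
  have h : ∀ n : ℕ, (1 - x) * Real.exp (-(x * Real.log (n + 1))) ≤
      coeff (n + 1) (oneSubPow (x - 1)) := by
    intro n
    induction n with
    | zero => rw [coeff_succ_oneSubPow_sub_one]; simp [constantCoeff_oneSubPow]
    | succ n ih =>
      have hpos : (0 : ℝ) < n + 1 := by positivity
      have hpos2 : (0 : ℝ) < n + 2 := by positivity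
      have h1 : Real.exp (-(x * (Real.log (n + 2) - Real.log (n + 1)))) ≤ 1 - x / (n + 2) := by
        have h2 := rpow_one_add_le_one_add_mul_self (s := -(1 / (n + 2 : ℝ))) (p := x)
          (by
            have : 1 / (n + 2 : ℝ) ≤ 1 := by
              rw [div_le_one hpos2]
              linarith
            linarith) hx hx1
        have h3 : 1 + -(1 / (n + 2 : ℝ)) = (n + 1) / (n + 2) := by
          field_simp
          ring
        rw [h3, Real.rpow_def_of_pos (by positivity), Real.log_div hpos.ne' hpos2.ne'] at h2
        calc _ = Real.exp ((Real.log (n + 1) - Real.log (n + 2)) * x) := by congr 1; ring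
          _ ≤ _ := h2
          _ = _ := by ring
      rw [coeff_succ_oneSubPow_sub_one]
      push_cast
      rw [add_assoc (n : ℝ) 1 1, one_add_one_eq_two]
      have h0 : 0 ≤ (1 - x) * Real.exp (-(x * Real.log (n + 1))) :=
        mul_nonneg (by linarith) (Real.exp_pos _).le
      refine le_trans (le_of_eq ?_) (mul_le_mul ih h1 (Real.exp_pos _).le (h0.trans ih))
      rw [mul_assoc, ← Real.exp_add]
      congr 2
      ring
  cases n with
  | zero => simp [constantCoeff_oneSubPow, hx]
  | succ n =>
    refine le_trans ?_ (h n)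
    have hlog : Real.log (n + 1) ≤ Real.log ((n + 1 : ℕ) + 1) :=
      Real.log_le_log (by positivity) (by push_cast; linarith)
    gcongr

/-- The coefficient is `Γ(n + a) / (Γ(a) n!)`. Log-convexity of `Γ`, applied once around `n + a + 1`
and once around `n + 1`, encloses `Γ(n + a) / n!` between `(n + 1) ^ (a - 1)` and that times `(n +
1) / (n + a)`. -/
theorem isBigO_coeff_oneSubPow_sub_rpow {a : ℝ} (ha : 0 < a) (ha1 : a < 1) :
    (fun n => coeff n (oneSubPow (-a)) - (n + 1 : ℝ) ^ (a - 1) / Real.Gamma a) =O[atTop]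
      fun n : ℕ => (n + 1 : ℝ) ^ (a - 2) := by
  have hΓ : 0 < Real.Gamma a := Real.Gamma_pos_of_pos ha
  have hcoeff : ∀ n : ℕ, coeff n (oneSubPow (-a)) * (Real.Gamma a * n.factorial) =
      Real.Gamma (n + a) := by
    intro n
    induction n with
    | zero => simp [constantCoeff_oneSubPow]
    | succ n ih =>
      have h1 := coeff_succ_oneSubPow (-a) n
      have h2 : Real.Gamma ((n + 1 : ℕ) + a) = (n + a) * Real.Gamma (n + a) := by
        rw [← Real.Gamma_add_one (by positivity)]
        push_cast
        ring_nf
      rw [h2, ← ih, Nat.factorial_succ]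
      push_cast
      linear_combination Real.Gamma a * n.factorial * h1
  refine Asymptotics.IsBigO.of_bound ((1 - a) / a / Real.Gamma a) (Eventually.of_forall fun n => ?_)
  have hn1 : (0 : ℝ) < n + 1 := by positivity
  have hna : (0 : ℝ) < n + a := by positivity
  have hfac : (0 : ℝ) < n.factorial := by positivity
  have hΓn : 0 < Real.Gamma (n + a) := Real.Gamma_pos_of_pos hna
  have hΓ1 : Real.Gamma (n + 1) = n.factorial := Real.Gamma_nat_eq_factorial n
  have hstep : Real.Gamma (n + a + 1) = (n + a) * Real.Gamma (n + a) :=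
    Real.Gamma_add_one hna.ne'
  -- upper bound
  have hup : (n + a) * Real.Gamma (n + a) ≤ n.factorial * (n + 1 : ℝ) ^ a := by
    have h := Real.Gamma_mul_add_mul_le_rpow_Gamma_mul_rpow_Gamma (s := n + 1) (t := n + 2)
      (a := 1 - a) (b := a) hn1 (by positivity) (by linarith) ha (by ring)
    have h2 : Real.Gamma (n + 2) = (n + 1) * n.factorial := by
      rw [← hΓ1, ← Real.Gamma_add_one hn1.ne']
      ring_nf
    rw [show (1 - a) * (n + 1 : ℝ) + a * (n + 2) = n + a + 1 by ring, hstep, hΓ1, h2,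
      Real.mul_rpow hn1.le hfac.le, mul_left_comm, ← Real.rpow_add hfac, sub_add_cancel,
      Real.rpow_one, mul_comm] at h
    linarith
  -- lower bound
  have hlow : n.factorial ≤ Real.Gamma (n + a) * (n + 1 : ℝ) ^ (1 - a) := by
    have h := Real.Gamma_mul_add_mul_le_rpow_Gamma_mul_rpow_Gamma (s := n + a) (t := n + a + 1)
      (a := a) (b := 1 - a) hna (by positivity) ha (by linarith) (by ring)
    rw [show a * (n + a : ℝ) + (1 - a) * (n + a + 1) = n + 1 by ring, hstep, hΓ1,
      Real.mul_rpow hna.le hΓn.le, mul_left_comm, ← Real.rpow_add hΓn, add_sub_cancel,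
      Real.rpow_one, mul_comm] at h
    refine h.trans (mul_le_mul_of_nonneg_left ?_ hΓn.le)
    exact Real.rpow_le_rpow hna.le (by linarith) (by linarith)
  have hE : coeff n (oneSubPow (-a)) = Real.Gamma (n + a) / n.factorial / Real.Gamma a := by
    rw [← hcoeff n]
    field_simp
  set u : ℝ := (n + 1 : ℝ) ^ (a - 1) with hu
  have hu0 : 0 < u := Real.rpow_pos_of_pos hn1 _
  have hua : (n + 1 : ℝ) ^ a = u * (n + 1) := by
    rw [hu, ← Real.rpow_add_one hn1.ne', sub_add_cancel]
  have hu1 : u * (n + 1 : ℝ) ^ (1 - a) = 1 := by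
    rw [hu, ← Real.rpow_add hn1]
    simp
  have hu2 : (n + 1 : ℝ) ^ (a - 2) = u / (n + 1) := by
    rw [hu, ← Real.rpow_sub_one hn1.ne']
    congr 1
    ring
  have h1 : u ≤ Real.Gamma (n + a) / n.factorial := by
    rw [le_div_iff₀ hfac]
    calc u * n.factorial ≤ u * (Real.Gamma (n + a) * (n + 1 : ℝ) ^ (1 - a)) := by gcongr
      _ = Real.Gamma (n + a) := by linear_combination Real.Gamma (n + a) * hu1
  have h2 : Real.Gamma (n + a) / n.factorial ≤ u * ((n + 1) / (n + a)) := by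
    rw [hua] at hup
    rw [div_le_iff₀ hfac, ← mul_div_assoc, div_mul_eq_mul_div, le_div_iff₀ hna]
    linarith
  have h3 : u * ((n + 1) / (n + a)) - u ≤ (1 - a) / a * (u / (n + 1)) := by
    have h4 : u * ((n + 1) / (n + a)) - u = (1 - a) * u * (1 / (n + a)) := by
      field_simp
      ring
    have h5 : 1 / (n + a) ≤ 1 / (a * (n + 1)) := by
      refine one_div_le_one_div_of_le (by positivity) ?_
      have : (0 : ℝ) ≤ n := Nat.cast_nonneg n
      nlinarith
    rw [h4]
    refine (mul_le_mul_of_nonneg_left h5 (mul_nonneg (by linarith) hu0.le)).trans (le_of_eq ?_)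
    field_simp
  rw [hE, ← sub_div, hu2, Real.norm_eq_abs, abs_div, abs_of_pos hΓ, abs_of_nonneg (by linarith),
    Real.norm_of_nonneg (by positivity), div_mul_eq_mul_div]
  gcongr
  linarith

/-! ### The case `p ≠ 1 / 2` -/

theorem oneSubPow_mul_inv_eq_add {c : ℝ} (hc : 1 < c) (δ β : ℝ) :
    oneSubPow β * (1 - c • oneSubPow δ)⁻¹ =
      oneSubPow β + c • (oneSubPow (β + δ) * (1 - c • oneSubPow δ)⁻¹) := by
  have hinv : (1 - c • oneSubPow δ) * (1 - c • oneSubPow δ)⁻¹ = 1 :=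
    PowerSeries.mul_inv_cancel _ (by simpa [constantCoeff_oneSubPow, sub_eq_zero] using hc.ne)
  rw [oneSubPow_add]
  rw [smul_eq_C_mul] at hinv ⊢
  rw [smul_eq_C_mul]
  linear_combination oneSubPow β * hinv

/-- Splitting off `(1 - X) ^ β` raises the exponent of the numerator by `δ` and costs only `O(n ^
(-(β + 1)))`. After finitely many steps the exponent is at least `2` and the pole estimate applies.
-/
theorem isBigO_coeff_oneSubPow_mul_inv_of_le {c δ x : ℝ} (hc : 1 < c) (hδ : 0 < δ) (hδ1 : δ < 1)
    (hx0 : 0 ≤ x) (hx2 : x ≤ 2) {β : ℝ} (hβ : x ≤ β + 1) :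
    (fun n => coeff n (oneSubPow β * (1 - c • oneSubPow δ)⁻¹) +
      (c ^ (-1 / δ)) ^ (β + 1) / δ * ((1 - c ^ (-1 / δ))⁻¹) ^ (n + 1)) =O[atTop]
        fun n : ℕ => (n + 1 : ℝ) ^ (-x) := by
  have hc0 : 0 < c := by linarith
  have hy0 : 0 < c ^ (-1 / δ) := Real.rpow_pos_of_pos hc0 _
  have hyδ : c * (c ^ (-1 / δ)) ^ δ = 1 := by
    rw [← Real.rpow_mul hc0.le, div_mul_cancel₀ _ hδ.ne', Real.rpow_neg_one,
      mul_inv_cancel₀ hc0.ne']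
  have hmono : ∀ z, x ≤ z → (fun n : ℕ => (n + 1 : ℝ) ^ (-z)) =O[atTop]
      fun n : ℕ => (n + 1 : ℝ) ^ (-x) := by
    intro z hz
    refine Asymptotics.IsBigO.of_bound 1 (Eventually.of_forall fun n => ?_)
    have hn1 : (0 : ℝ) < n + 1 := by positivity
    rw [one_mul, Real.norm_of_nonneg (Real.rpow_nonneg hn1.le _),
      Real.norm_of_nonneg (Real.rpow_nonneg hn1.le _)]
    exact Real.rpow_le_rpow_of_exponent_le (by linarith [(Nat.cast_nonneg n : (0 : ℝ) ≤ n)])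
      (by linarith)
  obtain ⟨k, hk⟩ := exists_nat_ge ((2 - β) / δ)
  rw [div_le_iff₀ hδ] at hk
  induction k generalizing β with
  | zero =>
    refine (isBigO_coeff_oneSubPow_mul_inv hc hδ hδ1 (by simpa using hk)).trans
      (Asymptotics.IsBigO.trans ?_ (hmono 2 hx2))
    refine Asymptotics.IsBigO.of_bound 4 ?_
    filter_upwards [eventually_ge_atTop 1] with n hn
    have hn' : (1 : ℝ) ≤ n := by exact_mod_cast hn
    have hn1 : (0 : ℝ) < n + 1 := by positivity
    rw [Real.rpow_neg hn1.le, Real.rpow_two, norm_inv, norm_inv, Real.norm_of_nonneg (by positivity),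
      Real.norm_of_nonneg (by positivity), ← div_eq_mul_inv, inv_eq_one_div,
      div_le_div_iff₀ (by positivity) (by positivity)]
    nlinarith
  | succ k ih =>
    have h1 := ih (β := β + δ) (by linarith) (by push_cast at hk; linarith)
    have h2 := (isBigO_coeff_oneSubPow_sub_one (x := β + 1) (by linarith)).trans (hmono _ hβ)
    rw [add_sub_cancel_right] at h2
    refine (h2.add (h1.const_mul_left c)).congr_left fun n => ?_
    rw [oneSubPow_mul_inv_eq_add hc δ β, map_add, coeff_smul, smul_eq_mul,
      show β + δ + 1 = (β + 1) + δ by ring, Real.rpow_add hy0]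
    -- The polar term is the same at every stage because `c * y ^ δ = 1` at the pole.
    linear_combination ((c ^ (-1 / δ)) ^ (β + 1) / δ * ((1 - c ^ (-1 / δ))⁻¹) ^ (n + 1)) * hyδ

theorem growthRate_eq_of_ne_half {p : ℝ} (hp : p ≠ 1 / 2) :
    growthRate p = (1 - (p / (1 - p)) ^ (1 / (1 - 2 * p)))⁻¹ := by
  rw [growthRate, if_neg hp, growthRateGeneric, one_div]

/-- With `δ = 1 - 2p` and `c = (1 - p) / p` the generating function is `-(δ / p) (1 - X) ^ (δ - 1) /
(1 - c (1 - X) ^ δ)`. The first term split off, `(1 - X) ^ (-2p)`, gives the main part of the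
remainder. -/
theorem isBigO_expectedPaths_of_lt_half (p : unitInterval) (hp0 : 0 < (p : ℝ))
    (hp : (p : ℝ) < 1 / 2) :
    (fun m : ℕ => expectedPaths p (m + 1) - 1 / (1 - p) * growthRate p ^ (m + 1) -
      -((1 - 2 * p) / (p * Real.Gamma (2 * p)) * (m + 1 : ℝ) ^ (2 * p - 1 : ℝ))) =O[atTop]
        fun m : ℕ => (m + 1 : ℝ) ^ (2 * (2 * p - 1) : ℝ) := by
  set q : ℝ := (p : ℝ) with hq
  set δ : ℝ := 1 - 2 * q with hδ
  set c : ℝ := (1 - q) / q with hc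
  have hδ0 : 0 < δ := by linarith
  have hδ1 : δ < 1 := by linarith
  have hc1 : 1 < c := by rw [hc, one_lt_div hp0]; linarith
  have hc0 : 0 < c := by linarith
  set y : ℝ := c ^ (-1 / δ) with hy
  have hy0 : 0 < y := Real.rpow_pos_of_pos hc0 _
  have hyδ : c * y ^ δ = 1 := by
    rw [hy, ← Real.rpow_mul hc0.le, div_mul_cancel₀ _ hδ0.ne', Real.rpow_neg_one,
      mul_inv_cancel₀ hc0.ne']
  have hα : growthRate q = (1 - y)⁻¹ := by
    rw [growthRate_eq_of_ne_half hp.ne, hy, hc, neg_div, Real.rpow_neg (by positivity),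
      ← Real.inv_rpow (by positivity), inv_div]
  have hcoeff : ∀ m, expectedPaths p (m + 1) = -(δ / q) *
      (coeff m (oneSubPow (δ - 1)) + c * coeff m (oneSubPow (2 * δ - 1) * (1 - c • oneSubPow δ)⁻¹)) := by
    intro m
    have h1 := oneSubPow_mul_inv_eq_add hc1 δ (δ - 1)
    suffices hser : oneSubPow (-1) * (1 - (q / (2 * q - 1)) • (1 - oneSubPow (2 * q - 1)))⁻¹ =
        C (-(δ / q)) * (oneSubPow (δ - 1) * (1 - c • oneSubPow δ)⁻¹) by
      rw [expectedPaths_eq_coeff_of_ne_half p hp.ne, ← hq, hser, coeff_C_mul, h1, map_add,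
        coeff_smul, smul_eq_mul, show 2 * δ - 1 = δ - 1 + δ by ring]
    rw [show 2 * q - 1 = -δ by ring]
    have hP : oneSubPow (-δ) * oneSubPow δ = 1 := by
      rw [← oneSubPow_add, neg_add_cancel, oneSubPow_zero]
    have hO : oneSubPow (δ - 1) = oneSubPow (-1) * oneSubPow δ := by
      rw [← oneSubPow_add]
      ring_nf
    set Z := 1 - (q / -δ) • (1 - oneSubPow (-δ)) with hZ
    set U := 1 - c • oneSubPow δ with hU
    have hZinv : Z * Z⁻¹ = 1 :=
      PowerSeries.mul_inv_cancel _ (by simp [hZ, constantCoeff_oneSubPow, smul_eq_C_mul])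
    have hUinv : U * U⁻¹ = 1 :=
      PowerSeries.mul_inv_cancel _ (by
        simpa [hU, constantCoeff_oneSubPow, sub_eq_zero] using hc1.ne)
    have hq1 : C (-(δ / q)) * C (q / -δ) = (1 : ℝ⟦X⟧) := by
      rw [← map_mul, show -(δ / q) * (q / -δ) = 1 by field_simp, map_one]
    have hq2 : C (q / -δ) * C c = C (q / -δ) - (1 : ℝ⟦X⟧) := by
      rw [← map_mul, show q / -δ * c = q / -δ - 1 by rw [hc]; field_simp; ring, map_sub, map_one]
    have hZU : Z * oneSubPow δ = C (q / -δ) * U := by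
      rw [hZ, hU]
      simp only [smul_eq_C_mul]
      linear_combination C (q / -δ) * hP + oneSubPow δ * hq2
    rw [hO]
    linear_combination -oneSubPow (-1) * Z⁻¹ * hUinv -
      oneSubPow (-1) * U⁻¹ * Z⁻¹ * U * hq1 - oneSubPow (-1) * U⁻¹ * Z⁻¹ * C (-(δ / q)) * hZU +
      oneSubPow (-1) * U⁻¹ * C (-(δ / q)) * oneSubPow δ * hZinv
  have h1 := (isBigO_coeff_oneSubPow_sub_rpow (a := 2 * q) (by linarith) (by linarith)).trans
    (show _ =O[atTop] fun n : ℕ => (n + 1 : ℝ) ^ (2 * (2 * q - 1)) by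
      refine Asymptotics.IsBigO.of_bound 1 (Eventually.of_forall fun n => ?_)
      have hn1 : (0 : ℝ) < n + 1 := by positivity
      rw [one_mul, Real.norm_of_nonneg (Real.rpow_nonneg hn1.le _),
        Real.norm_of_nonneg (Real.rpow_nonneg hn1.le _)]
      exact Real.rpow_le_rpow_of_exponent_le (by linarith [(Nat.cast_nonneg n : (0 : ℝ) ≤ n)])
        (by linarith))
  have h2 := isBigO_coeff_oneSubPow_mul_inv_of_le hc1 hδ0 hδ1 (x := 2 * δ) (by linarith)
    (by linarith) (β := 2 * δ - 1) (by linarith)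
  rw [show -(2 * δ) = 2 * (2 * q - 1) by rw [hδ]; ring] at h2
  refine ((h1.const_mul_left (-(δ / q))).add (h2.const_mul_left (-(δ / q) * c))).congr_left
    fun n => ?_
  have hyy : c * (y ^ (2 * δ)) = y ^ δ := by
    rw [two_mul, Real.rpow_add hy0, ← mul_assoc, hyδ, one_mul]
  have hyq : y ^ δ * (1 - q) = q := by
    rw [hc] at hyδ
    field_simp at hyδ
    linarith
  have h1q : (1 - q) ≠ 0 := by linarith
  have hΓ : Real.Gamma (2 * q) ≠ 0 := (Real.Gamma_pos_of_pos (by linarith)).ne'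
  have hpole : -(δ / q) * c * (y ^ (2 * δ) / δ) = -(1 / (1 - q)) := by
    calc _ = -(δ / q) * (c * (y ^ (2 * δ))) / δ := by ring
      _ = -(y ^ δ / q) := by rw [hyy]; field_simp
      _ = _ := by rw [← neg_div, ← neg_div, div_eq_div_iff hp0.ne' h1q]; linarith
  rw [hcoeff, hα, sub_add_cancel, show -(2 * q) = δ - 1 by rw [hδ]; ring]
  have hpole' := congrArg (fun t => t * (1 - y)⁻¹ ^ (n + 1)) hpole
  have hΓ' : δ / (q * Real.Gamma (2 * q)) = δ / q / Real.Gamma (2 * q) := by rw [div_div]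
  rw [hΓ']
  linear_combination hpole'

/-- Now `δ = 2p - 1`, `c = p / (1 - p)` and the numerator is a multiple of `(1 - X)⁻¹`, so the first
term split off has constant coefficients. -/
theorem isBigO_expectedPaths_of_half_lt (p : unitInterval) (hp1 : (p : ℝ) < 1)
    (hp : 1 / 2 < (p : ℝ)) :
    (fun m : ℕ => expectedPaths p (m + 1) - 1 / (1 - p) * growthRate p ^ (m + 1) -
      -((2 * p - 1) / (1 - p))) =O[atTop] fun m : ℕ => (m + 1 : ℝ) ^ (1 - 2 * p : ℝ) := by
  set q : ℝ := (p : ℝ) with hq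
  set δ : ℝ := 2 * q - 1 with hδ
  set c : ℝ := q / (1 - q) with hc
  have h1q : 0 < 1 - q := by linarith
  have hδ0 : 0 < δ := by linarith
  have hδ1 : δ < 1 := by linarith
  have hc1 : 1 < c := by rw [hc, one_lt_div h1q]; linarith
  have hc0 : 0 < c := by linarith
  set y : ℝ := c ^ (-1 / δ) with hy
  have hy0 : 0 < y := Real.rpow_pos_of_pos hc0 _
  have hyδ : c * y ^ δ = 1 := by
    rw [hy, ← Real.rpow_mul hc0.le, div_mul_cancel₀ _ hδ0.ne', Real.rpow_neg_one,
      mul_inv_cancel₀ hc0.ne']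
  have hα : growthRate q = (1 - y)⁻¹ := by
    rw [growthRate_eq_of_ne_half hp.ne', hy, show 1 - 2 * q = -δ by rw [hδ]; ring, div_neg, neg_div]
  have hcoeff : ∀ m, expectedPaths p (m + 1) = -(δ / (1 - q)) *
      (coeff m (oneSubPow (-1)) + c * coeff m (oneSubPow (δ - 1) * (1 - c • oneSubPow δ)⁻¹)) := by
    intro m
    have h1 := oneSubPow_mul_inv_eq_add hc1 δ (-1)
    suffices hser : oneSubPow (-1) * (1 - (q / δ) • (1 - oneSubPow δ))⁻¹ =
        C (-(δ / (1 - q))) * (oneSubPow (-1) * (1 - c • oneSubPow δ)⁻¹) by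
      rw [expectedPaths_eq_coeff_of_ne_half p hp.ne', ← hq, ← hδ, hser, coeff_C_mul, h1, map_add,
        coeff_smul, smul_eq_mul, neg_add_eq_sub]
    set Z := 1 - (q / δ) • (1 - oneSubPow δ) with hZ
    set U := 1 - c • oneSubPow δ with hU
    have hZinv : Z * Z⁻¹ = 1 :=
      PowerSeries.mul_inv_cancel _ (by simp [hZ, constantCoeff_oneSubPow, smul_eq_C_mul])
    have hUinv : U * U⁻¹ = 1 :=
      PowerSeries.mul_inv_cancel _ (by
        simpa [hU, constantCoeff_oneSubPow, sub_eq_zero] using hc1.ne)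
    have hqδ : 1 - q / δ = -((1 - q) / δ) := by
      rw [one_sub_div hδ0.ne', ← neg_div]
      congr 1
      linarith
    have hq1 : C (-(δ / (1 - q))) * C (1 - q / δ) = (1 : ℝ⟦X⟧) := by
      rw [← map_mul, show -(δ / (1 - q)) * (1 - q / δ) = 1 by rw [hqδ]; field_simp, map_one]
    have hq2 : C (1 - q / δ) * C c = -C (q / δ) := by
      rw [← map_mul, show (1 - q / δ) * c = -(q / δ) by rw [hqδ, hc]; field_simp, map_neg]
    have hZU : Z = C (1 - q / δ) * U := by
      have h3 : (C (1 - q / δ) : ℝ⟦X⟧) = 1 - C (q / δ) := by simp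
      rw [hZ, hU]
      simp only [smul_eq_C_mul]
      linear_combination oneSubPow δ * hq2 - h3
    linear_combination -oneSubPow (-1) * Z⁻¹ * hUinv -
      oneSubPow (-1) * U⁻¹ * Z⁻¹ * U * hq1 - oneSubPow (-1) * U⁻¹ * Z⁻¹ * C (-(δ / (1 - q))) * hZU +
      oneSubPow (-1) * U⁻¹ * C (-(δ / (1 - q))) * hZinv
  have h2 := isBigO_coeff_oneSubPow_mul_inv_of_le hc1 hδ0 hδ1 (x := δ) hδ0.le
    (by linarith) (β := δ - 1) (by linarith)
  rw [show -δ = 1 - 2 * q by rw [hδ]; ring] at h2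
  refine (h2.const_mul_left (-(δ / (1 - q)) * c)).congr_left fun n => ?_
  have hone : coeff n (oneSubPow (-1)) = 1 := by
    rw [coeff_oneSubPow_eq_prod]
    simp
  rw [hcoeff, hα, sub_add_cancel, hone]
  have hpole : -(δ / (1 - q)) * c * (y ^ δ / δ) = -(1 / (1 - q)) := by
    calc _ = -(δ / (1 - q)) * (c * y ^ δ) / δ := by ring
      _ = _ := by rw [hyδ]; field_simp
  have hpole' := congrArg (fun t => t * (1 - y)⁻¹ ^ (n + 1)) hpole
  linear_combination hpole'

/-- The logarithm of the inner power is `-1/2` times the difference quotient at `1/2` of `log p -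
log (1 - p)`, whose derivative there is `4`. -/
theorem tendsto_growthRateGeneric_half :
    Tendsto growthRateGeneric (𝓝[≠] (1 / 2)) (𝓝 (growthRate (1 / 2))) := by
  rw [growthRate, if_pos rfl]
  have hderiv : HasDerivAt (fun p : ℝ => Real.log p - Real.log (1 - p)) 4 (1 / 2) := by
    have h1 : HasDerivAt (fun p : ℝ => 1 - p) (-1) (1 / 2) := by
      simpa using (hasDerivAt_id (1 / 2 : ℝ)).const_sub 1
    have h2 := (Real.hasDerivAt_log (x := 1 / 2) (by norm_num)).sub (h1.log (by norm_num))
    rw [show (1 / 2 : ℝ)⁻¹ - -1 / (1 - 1 / 2) = 4 by norm_num] at h2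
    exact h2
  have hslope := hasDerivAt_iff_tendsto_slope.1 hderiv
  have hexp : Tendsto (fun p : ℝ => (p / (1 - p)) ^ (1 / (1 - 2 * p))) (𝓝[≠] (1 / 2))
      (𝓝 (Real.exp (-2))) := by
    have h1 : Tendsto (fun p => Real.exp (slope (fun p : ℝ => Real.log p - Real.log (1 - p))
        (1 / 2) p * (-1 / 2))) (𝓝[≠] (1 / 2)) (𝓝 (Real.exp (4 * (-1 / 2)))) :=
      (Real.continuous_exp.tendsto _).comp (hslope.mul_const _)
    rw [show (4 * (-1 / 2) : ℝ) = -2 by norm_num] at h1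
    refine h1.congr' ?_
    filter_upwards [self_mem_nhdsWithin,
      nhdsWithin_le_nhds (Ioo_mem_nhds (show (0 : ℝ) < 1 / 2 by norm_num)
        (show (1 / 2 : ℝ) < 1 by norm_num))] with p hp1 hp2
    have h3 : 0 < 1 - p := by linarith [hp2.2]
    rw [Real.rpow_def_of_pos (div_pos hp2.1 h3), Real.log_div hp2.1.ne' h3.ne', slope_def_field]
    congr 1
    have h4 : p - 1 / 2 ≠ 0 := sub_ne_zero.2 hp1
    have h5 : 1 - 2 * p ≠ 0 := fun h => h4 (by linarith)
    rw [show (1 : ℝ) - 1 / 2 = 1 / 2 by norm_num, sub_self, sub_zero,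
      show p - 1 / 2 = -(1 - 2 * p) / 2 by ring]
    field_simp
  have h : (1 : ℝ) - Real.exp (-2) ≠ 0 :=
    (sub_pos.2 (Real.exp_lt_one_iff.2 (by norm_num))).ne'
  exact tendsto_const_nhds.div (tendsto_const_nhds.sub hexp) h

/-! ### The case `p = 1 / 2` -/

/-- Coefficientwise form of `d/dx (1 - X) ^ x = log (1 - X) * (1 - X) ^ x`. -/
theorem hasDerivAt_coeff_oneSubPow (n : ℕ) (x : ℝ) :
    HasDerivAt (fun x => coeff n (oneSubPow x))
      (coeff n (-antideriv (oneSubPow (-1)) * oneSubPow x)) x := by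
  set V := antideriv (oneSubPow (-1)) with hV
  have hode : (1 - X) * d⁄dX ℝ (-V * oneSubPow x) =
      -oneSubPow x - x • (-V * oneSubPow x) := by
    have h1 := one_sub_X_mul_derivative_oneSubPow x
    have h2 : (1 - X) * oneSubPow (-1) = 1 := by
      rw [← oneSubPow_one, ← oneSubPow_add, ← oneSubPow_zero]
      norm_num
    rw [Derivation.leibniz, map_neg, derivative_antideriv]
    simp only [smul_eq_C_mul, smul_eq_mul, map_neg] at h1 ⊢
    linear_combination -V * h1 - oneSubPow x * h2
  induction n with
  | zero =>
    have h : (fun x => coeff 0 (oneSubPow x)) = fun _ => (1 : ℝ) := by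
      funext x
      rw [coeff_zero_eq_constantCoeff_apply, constantCoeff_oneSubPow]
    rw [h, coeff_zero_eq_constantCoeff_apply, map_mul, map_neg, constantCoeff_antideriv]
    simpa using hasDerivAt_const x (1 : ℝ)
  | succ n ih =>
    have hn : (n + 1 : ℝ) ≠ 0 := by positivity
    have h : (fun x => coeff (n + 1) (oneSubPow x)) =
        fun x => (n - x) * coeff n (oneSubPow x) / (n + 1) := by
      funext x
      rw [← coeff_succ_oneSubPow, mul_div_cancel_left₀ _ hn]
    have h1 := congrArg (coeff n) hode
    rw [coeff_one_sub_X_mul_derivative, map_sub, map_neg, coeff_smul, smul_eq_mul] at h1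
    have h2 : HasDerivAt (fun x : ℝ => n - x) (-1) x := by
      simpa using (hasDerivAt_id x).const_sub (n : ℝ)
    rw [h]
    refine ((h2.fun_mul ih).div_const (n + 1 : ℝ)).congr_deriv ?_
    rw [div_eq_iff hn]
    linear_combination -h1

theorem continuous_coeff_oneSubPow (n : ℕ) : Continuous fun x => coeff n (oneSubPow x) :=
  continuous_iff_continuousAt.2 fun x => (hasDerivAt_coeff_oneSubPow n x).continuousAt

/-- Differentiating `exp (2x) (1 - X) ^ (x - 1)` in `x` produces the factor `2 + log (1 - X)`, twice
the denominator, so multiplying by its inverse gives a primitive of the integrand. -/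
theorem integral_exp_mul_coeff_oneSubPow (n : ℕ) (b : ℝ) :
    ∫ x in (0 : ℝ)..b, 2 * Real.exp (2 * x) * coeff n (oneSubPow (x - 1)) =
      Real.exp (2 * b) * coeff n (oneSubPow (b - 1) *
        (1 - (1 / 2 : ℝ) • antideriv (oneSubPow (-1)))⁻¹) -
      coeff n (oneSubPow (-1) * (1 - (1 / 2 : ℝ) • antideriv (oneSubPow (-1)))⁻¹) := by
  set V := antideriv (oneSubPow (-1)) with hV
  set U := (1 - (1 / 2 : ℝ) • V)⁻¹ with hU
  have hinv : (1 - (1 / 2 : ℝ) • V) * U = 1 :=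
    PowerSeries.mul_inv_cancel _ (by simp [hV, constantCoeff_antideriv])
  have hderiv : ∀ x, HasDerivAt (fun x => Real.exp (2 * x) * coeff n (oneSubPow (x - 1) * U))
      (2 * Real.exp (2 * x) * coeff n (oneSubPow (x - 1))) x := by
    intro x
    have h1 : HasDerivAt (fun x => Real.exp (2 * x)) (Real.exp (2 * x) * 2) x := by
      simpa using ((hasDerivAt_id x).const_mul 2).exp
    have h2 : HasDerivAt (fun x => coeff n (oneSubPow (x - 1) * U))
        (coeff n (-V * oneSubPow (x - 1) * U)) x := by
      simp only [coeff_mul n _ U]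
      refine HasDerivAt.fun_sum fun i _ => HasDerivAt.mul_const ?_ _
      exact (hasDerivAt_coeff_oneSubPow i.1 (x - 1)).comp_sub_const x 1
    have h3 : -V * oneSubPow (x - 1) * U =
        (2 : ℝ) • oneSubPow (x - 1) - (2 : ℝ) • (oneSubPow (x - 1) * U) := by
      have h4 : C (2 : ℝ) * C (1 / 2 : ℝ) = (1 : ℝ⟦X⟧) := by
        rw [← map_mul]
        norm_num
      simp only [smul_eq_C_mul] at hinv ⊢
      linear_combination C (2 : ℝ) * oneSubPow (x - 1) * hinv + V * oneSubPow (x - 1) * U * h4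
    rw [h3, map_sub, coeff_smul, coeff_smul, smul_eq_mul, smul_eq_mul] at h2
    refine (h1.fun_mul h2).congr_deriv ?_
    ring
  rw [intervalIntegral.integral_eq_sub_of_hasDerivAt (fun x _ => hderiv x)]
  · simp
  · refine Continuous.intervalIntegrable ?_ _ _
    have := (continuous_coeff_oneSubPow n).comp (continuous_sub_right (1 : ℝ))
    exact (continuous_const.mul (Real.continuous_exp.comp (continuous_const.mul continuous_id))).mul
      this

/-- The integrand is at most `exp (-(L - 2) x)` with `L = log (n + 1)`. The condition `4 ≤ L` is
what `1 / (L - 2) ≤ 1 / L + 4 / L ^ 2` requires. -/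
theorem integral_exp_mul_coeff_le {n : ℕ} (hL : 4 ≤ Real.log (n + 1)) :
    ∫ x in (0 : ℝ)..1, Real.exp (2 * x) * coeff n (oneSubPow (x - 1)) ≤
      1 / Real.log (n + 1) + 4 / Real.log (n + 1) ^ 2 := by
  set L := Real.log (n + 1) with hLdef
  have hcont : Continuous fun x : ℝ => Real.exp (2 * x) * coeff n (oneSubPow (x - 1)) :=
    (by fun_prop : Continuous fun x : ℝ => Real.exp (2 * x)).mul
      ((continuous_coeff_oneSubPow n).comp (continuous_sub_right (1 : ℝ)))
  have hL2 : 0 < L - 2 := by linarith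
  have h1 : ∫ x in (0 : ℝ)..1, Real.exp (2 * x) * coeff n (oneSubPow (x - 1)) ≤
      ∫ x in (0 : ℝ)..1, Real.exp (-(L - 2) * x) := by
    refine intervalIntegral.integral_mono_on zero_le_one (hcont.intervalIntegrable _ _)
      (Continuous.intervalIntegrable (by fun_prop) _ _) fun x hx => ?_
    have h2 := abs_coeff_oneSubPow_sub_one_le (N := 0) (n := n) hx.1 (by simpa using hx.2)
      (Nat.zero_le _)
    simp only [coeff_zero_eq_constantCoeff, constantCoeff_oneSubPow, abs_one, Nat.cast_zero,
      zero_add, Real.log_one, mul_zero, Real.exp_zero, one_mul] at h2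
    refine (mul_le_mul_of_nonneg_left ((le_abs_self _).trans h2) (Real.exp_pos _).le).trans
      (le_of_eq ?_)
    rw [← Real.exp_add, ← hLdef]
    congr 1
    ring
  have h3 : ∫ x in (0 : ℝ)..1, Real.exp (-(L - 2) * x) =
      (1 - Real.exp (-(L - 2))) / (L - 2) := by
    have h4 : ∀ x : ℝ, HasDerivAt (fun x => -Real.exp (-(L - 2) * x) / (L - 2))
        (Real.exp (-(L - 2) * x)) x := by
      intro x
      refine ((((hasDerivAt_id' x).const_mul (-(L - 2))).exp.fun_neg).div_const (L - 2)).congr_deriv ?_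
      field_simp
    rw [intervalIntegral.integral_eq_sub_of_hasDerivAt (fun x _ => h4 x)
      (Continuous.intervalIntegrable (by fun_prop) _ _)]
    simp
    ring
  refine (h1.trans (le_of_eq h3)).trans ?_
  have h6 : (1 - Real.exp (-(L - 2))) / (L - 2) ≤ 1 / (L - 2) := by
    gcongr
    linarith [Real.exp_pos (-(L - 2))]
  refine h6.trans ?_
  have hL0 : 0 < L := by linarith
  rw [div_add_div _ _ hL0.ne' (by positivity), div_le_div_iff₀ hL2 (by positivity)]
  nlinarith [mul_pos hL0 hL2]

theorem le_integral_exp_mul_coeff {n : ℕ} (hL : 0 < Real.log (n + 1)) :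
    1 / Real.log (n + 1) - 1 / Real.log (n + 1) ^ 2 ≤
      ∫ x in (0 : ℝ)..1, Real.exp (2 * x) * coeff n (oneSubPow (x - 1)) := by
  set L := Real.log (n + 1) with hLdef
  have hcont : Continuous fun x : ℝ => Real.exp (2 * x) * coeff n (oneSubPow (x - 1)) :=
    (by fun_prop : Continuous fun x : ℝ => Real.exp (2 * x)).mul
      ((continuous_coeff_oneSubPow n).comp (continuous_sub_right (1 : ℝ)))
  have h1 : ∫ x in (0 : ℝ)..1, (1 - x) * Real.exp (-(x * L)) ≤
      ∫ x in (0 : ℝ)..1, Real.exp (2 * x) * coeff n (oneSubPow (x - 1)) := by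
    refine intervalIntegral.integral_mono_on zero_le_one
      (Continuous.intervalIntegrable (by fun_prop) _ _) (hcont.intervalIntegrable _ _)
      fun x hx => ?_
    have h2 := coeff_oneSubPow_sub_one_ge hx.1 hx.2 n
    have h3 : 0 ≤ (1 - x) * Real.exp (-(x * L)) :=
      mul_nonneg (by linarith [hx.2]) (Real.exp_pos _).le
    have h4 : 1 ≤ Real.exp (2 * x) := Real.one_le_exp (by linarith [hx.1])
    nlinarith [h3.trans h2]
  have h5 : ∫ x in (0 : ℝ)..1, (1 - x) * Real.exp (-(x * L)) =
      1 / L - 1 / L ^ 2 + Real.exp (-L) / L ^ 2 := by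
    have h4 : ∀ x : ℝ, HasDerivAt (fun x => (-(1 - x) / L + 1 / L ^ 2) * Real.exp (-(x * L)))
        ((1 - x) * Real.exp (-(x * L))) x := by
      intro x
      have h6 : HasDerivAt (fun x : ℝ => -(1 - x) / L + 1 / L ^ 2) (1 / L) x := by
        have := ((((hasDerivAt_id x).const_sub 1).neg).div_const L).add_const (1 / L ^ 2)
        simpa using this
      have h7 : HasDerivAt (fun x : ℝ => Real.exp (-(x * L))) (Real.exp (-(x * L)) * -L) x := by
        simpa using (((hasDerivAt_id x).mul_const L).neg).exp
      refine (h6.fun_mul h7).congr_deriv ?_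
      field_simp
      ring
    rw [intervalIntegral.integral_eq_sub_of_hasDerivAt (fun x _ => h4 x)
      (Continuous.intervalIntegrable (by fun_prop) _ _)]
    simp
    ring
  refine le_trans ?_ (h5.symm.le.trans h1)
  have : 0 ≤ Real.exp (-L) / L ^ 2 := by positivity
  linarith

/-- For `1 ≤ x ≤ 2` the coefficient is already `O(1 / (n + 1))`. The constant combines `exp (2x) ≤
exp 4`, `2 ^ x ≤ exp 2` and `exp (-L) ≤ 2 / L ^ 2`. -/
theorem abs_integral_exp_mul_coeff_le {n : ℕ} (hn : 1 ≤ n) (hL : 0 < Real.log (n + 1)) :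
    |∫ x in (1 : ℝ)..2, Real.exp (2 * x) * coeff n (oneSubPow (x - 1))| ≤
      2 * Real.exp 6 / Real.log (n + 1) ^ 2 := by
  set L := Real.log (n + 1) with hLdef
  have h1 := intervalIntegral.norm_integral_le_of_norm_le_const (a := 1) (b := 2)
    (f := fun x : ℝ => Real.exp (2 * x) * coeff n (oneSubPow (x - 1)))
    (C := Real.exp 6 * Real.exp (-L)) (by
      intro x hx
      rw [Set.uIoc_of_le one_le_two] at hx
      have h2 := abs_coeff_oneSubPow_sub_one_le (x := x) (N := 1) (n := n) (by linarith [hx.1])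
        (by push_cast; linarith [hx.2]) hn
      have h20 := coeff_succ_oneSubPow_sub_one x 0
      rw [coeff_zero_eq_constantCoeff_apply, constantCoeff_oneSubPow, zero_add, Nat.cast_zero,
        zero_add, div_one, one_mul] at h20
      rw [h20, Nat.cast_one, one_add_one_eq_two] at h2
      have h3 : |1 - x| ≤ 1 := by rw [abs_le]; constructor <;> linarith [hx.1, hx.2]
      have h4 : Real.exp (x * Real.log 2) ≤ Real.exp 2 := by
        refine Real.exp_le_exp.2 ?_
        have h5 : Real.log 2 ≤ 1 := by linarith [Real.log_two_lt_d9]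
        nlinarith [hx.1, hx.2, Real.log_nonneg one_le_two]
      have h6 : Real.exp (-(x * L)) ≤ Real.exp (-L) :=
        Real.exp_le_exp.2 (by nlinarith [hx.1])
      have h7 : Real.exp (2 * x) ≤ Real.exp 4 := Real.exp_le_exp.2 (by linarith [hx.2])
      rw [norm_mul, Real.norm_of_nonneg (Real.exp_pos _).le, Real.norm_eq_abs]
      calc Real.exp (2 * x) * |coeff n (oneSubPow (x - 1))|
          ≤ Real.exp 4 * (1 * Real.exp 2 * Real.exp (-L)) := by
            refine mul_le_mul h7 (h2.trans ?_) (abs_nonneg _) (Real.exp_pos _).le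
            gcongr
        _ = Real.exp 6 * Real.exp (-L) := by
            rw [one_mul, ← mul_assoc, ← Real.exp_add]
            norm_num)
  rw [Real.norm_eq_abs] at h1
  refine h1.trans ?_
  have h8 : Real.exp (-L) ≤ 2 / L ^ 2 := by
    rw [Real.exp_neg, inv_eq_one_div, div_le_div_iff₀ (Real.exp_pos _) (by positivity)]
    have := Real.quadratic_le_exp_of_nonneg hL.le
    linarith
  calc Real.exp 6 * Real.exp (-L) * |2 - 1| ≤ Real.exp 6 * (2 / L ^ 2) * |2 - 1| := by gcongr
    _ = 2 * Real.exp 6 / L ^ 2 := by norm_num; ring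

/-- The integral identity is used with `b = 2`: its numerator `1 - X` vanishes at the singularity,
so beyond the pole it contributes only `O(1 / n)`, and the `1 / log n` term comes from the integral
near `x = 0`. -/
theorem isBigO_expectedPaths_of_eq_half (p : unitInterval) (hp : (p : ℝ) = 1 / 2) :
    (fun m : ℕ => expectedPaths p (m + 1) - 1 / (1 - p) * growthRate p ^ (m + 1) -
      -(2 / Real.log (m + 1))) =O[atTop] fun m : ℕ => 1 / Real.log (m + 1) ^ 2 := by
  have hLtop : Tendsto (fun m : ℕ => Real.log (m + 1)) atTop atTop :=
    Real.tendsto_log_atTop.comp (tendsto_natCast_atTop_atTop.atTop_add tendsto_const_nhds)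
  have hint : (fun m : ℕ => 1 / Real.log (m + 1) -
      ∫ x in (0 : ℝ)..2, Real.exp (2 * x) * coeff m (oneSubPow (x - 1))) =O[atTop]
      fun m : ℕ => 1 / Real.log (m + 1) ^ 2 := by
    refine Asymptotics.IsBigO.of_bound (4 + 2 * Real.exp 6) ?_
    filter_upwards [hLtop.eventually_ge_atTop 4, eventually_ge_atTop 1] with n hL hn
    have hcont : Continuous fun x : ℝ => Real.exp (2 * x) * coeff n (oneSubPow (x - 1)) :=
      (by fun_prop : Continuous fun x : ℝ => Real.exp (2 * x)).mul
        ((continuous_coeff_oneSubPow n).comp (continuous_sub_right (1 : ℝ)))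
    rw [← intervalIntegral.integral_add_adjacent_intervals (hcont.intervalIntegrable 0 1)
      (hcont.intervalIntegrable 1 2)]
    have h1 := integral_exp_mul_coeff_le hL
    have h2 := le_integral_exp_mul_coeff (n := n) (by linarith)
    have h3 := abs_le.1 (abs_integral_exp_mul_coeff_le hn (by linarith))
    have h4 : 0 ≤ 1 / Real.log (n + 1) ^ 2 := by positivity
    have h5 : 4 / Real.log (n + 1) ^ 2 = 4 * (1 / Real.log (n + 1) ^ 2) := by ring
    have h6 : 2 * Real.exp 6 / Real.log (n + 1) ^ 2 =
        2 * Real.exp 6 * (1 / Real.log (n + 1) ^ 2) := by ring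
    rw [h5] at h1
    rw [h6] at h3
    rw [Real.norm_eq_abs, Real.norm_of_nonneg h4, abs_le]
    constructor <;> linarith [h3.1, h3.2]
  have hpole : (fun n => coeff n (oneSubPow 1 * (1 - (1 / 2 : ℝ) • antideriv (oneSubPow (-1)))⁻¹) +
      -2 * Real.exp (-4) * ((1 - Real.exp (-2))⁻¹) ^ (n + 1)) =O[atTop]
      fun m : ℕ => 1 / Real.log (m + 1) ^ 2 := by
    refine isBigO_coeff_one_sub_mul_inv_log.trans (Asymptotics.IsBigO.of_bound 8 ?_)
    filter_upwards [hLtop.eventually_ge_atTop 4, eventually_ge_atTop 1] with n hL hn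
    have hn' : (1 : ℝ) ≤ n := by exact_mod_cast hn
    rw [pow_one, Real.norm_of_nonneg (by positivity), Real.norm_of_nonneg (by positivity),
      mul_one_div, inv_eq_one_div, div_le_div_iff₀ (by linarith) (by positivity)]
    have h1 := Real.quadratic_le_exp_of_nonneg (by linarith : 0 ≤ Real.log ((n : ℝ) + 1))
    rw [Real.exp_log (by positivity)] at h1
    nlinarith
  refine ((hpole.const_mul_left (Real.exp 4)).add (hint.const_mul_left 2)).congr_left fun n => ?_
  have h1 := integral_exp_mul_coeff_oneSubPow n 2
  rw [← expectedPaths_eq_coeff_of_eq_half p hp] at h1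
  norm_num at h1
  have h2 : ∫ x in (0 : ℝ)..2, 2 * Real.exp (2 * x) * coeff n (oneSubPow (x - 1)) =
      2 * ∫ x in (0 : ℝ)..2, Real.exp (2 * x) * coeff n (oneSubPow (x - 1)) := by
    rw [← intervalIntegral.integral_const_mul]
    congr 1
    funext x
    ring
  rw [h2] at h1
  have h3 : Real.exp 4 * Real.exp (-4) = 1 := by
    rw [← Real.exp_add]
    norm_num
  rw [hp, growthRate, if_pos rfl, one_div (1 - Real.exp (-2))]
  rw [show 1 / (1 - 1 / 2 : ℝ) = 2 by norm_num]
  linear_combination -h1 - 2 * (1 - Real.exp (-2))⁻¹ ^ (n + 1) * h3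

/-! ### Assembly of the theorem -/

theorem isBigO_atTop_of_succ {f g : ℕ → ℝ}
    (h : (fun m => f (m + 1)) =O[atTop] fun m => g (m + 1)) : f =O[atTop] g := by
  rw [← Filter.map_add_atTop_eq_nat 1, Asymptotics.isBigO_map]
  exact h

theorem mainTheorem4 :
    (∀ (p : ℝ) (hp0 : 0 < p) (hp1 : p < 1),
      -- the number of paths has a finite expectation
      (∀ m : ℕ, Integrable (fun G : Network (m + 1) => (G.numPaths : ℝ))
        (bernoulliNetwork ⟨p, hp0.le, hp1.le⟩ m).toMeasure) ∧
      -- explicit formulas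
      (p ≠ 1 / 2 → ∀ n : ℕ, 1 ≤ n →
        expectedPaths ⟨p, hp0.le, hp1.le⟩ n =
          ∑ j ∈ Finset.range n, (-1 : ℝ) ^ (n + j - 1) *
            Ring.choose ((2 * p - 1) * (j : ℝ) - 1) (n - 1) *
            ∑ k ∈ Finset.range n, (k.choose j : ℝ) * (p / (2 * p - 1)) ^ k) ∧
      (p = 1 / 2 → ∀ n : ℕ, 1 ≤ n →
        expectedPaths ⟨p, hp0.le, hp1.le⟩ n =
          ∑ k ∈ Finset.range n, (-1 : ℝ) ^ k / 2 ^ k *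
            completeBell k fun m => -((m - 1).factorial * harmonicNumber m (n - 1))) ∧
      -- asymptotic behaviour, with `R n` the remainder term
      (∀ R : ℕ → ℝ,
        (∀ n, R n = expectedPaths ⟨p, hp0.le, hp1.le⟩ n - 1 / (1 - p) * growthRate p ^ n) →
        (p < 1 / 2 →
          (fun n : ℕ => R n - -((1 - 2 * p) / (p * Real.Gamma (2 * p)) * (n : ℝ) ^ (2 * p - 1)))
            =O[atTop] fun n : ℕ => (n : ℝ) ^ (2 * (2 * p - 1))) ∧
        (p = 1 / 2 →
          (fun n : ℕ => R n - -(2 / Real.log n))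
            =O[atTop] fun n : ℕ => 1 / Real.log n ^ 2) ∧
        (1 / 2 < p →
          (fun n : ℕ => R n - -((2 * p - 1) / (1 - p)))
            =O[atTop] fun n : ℕ => (n : ℝ) ^ (1 - 2 * p)))) ∧
    -- the growth rate at `1 / 2` is the limit of the generic one
    Tendsto growthRateGeneric (𝓝[≠] (1 / 2)) (𝓝 (growthRate (1 / 2))) := by
  refine ⟨fun p hp0 hp1 => ⟨fun m => integrable_numPaths _ m, fun hp => ?_, fun hp => ?_,
    fun R hR => ⟨fun hp => ?_, fun hp => ?_, fun hp => ?_⟩⟩, tendsto_growthRateGeneric_half⟩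
  · exact expectedPaths_eq_sum_choose ⟨p, hp0.le, hp1.le⟩ hp
  · exact expectedPaths_eq_sum_completeBell ⟨p, hp0.le, hp1.le⟩ hp
  · refine isBigO_atTop_of_succ ?_
    simp only [hR, Nat.cast_add, Nat.cast_one]
    exact isBigO_expectedPaths_of_lt_half ⟨p, hp0.le, hp1.le⟩ hp0 hp
  · refine isBigO_atTop_of_succ ?_
    simp only [hR, Nat.cast_add, Nat.cast_one]
    exact isBigO_expectedPaths_of_eq_half ⟨p, hp0.le, hp1.le⟩ hp
  · refine isBigO_atTop_of_succ ?_
    simp only [hR, Nat.cast_add, Nat.cast_one]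
    exact isBigO_expectedPaths_of_half_lt ⟨p, hp0.le, hp1.le⟩ hp1 hp
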